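/- Let $0<p,q<\infty$. A weight is a nonnegative Lebesgue measurable, locally integrable function on $(0,\infty)$. Let $u$ be a continuous weight and let $v,w$ be weights such that, with $V(x):=\int_0^x v$ and $W(x):=\int_0^x w$, one has $0<V(x)<\infty$ and $0<W(x)<\infty$ for all $x>0$. For measurable $g\ge 0$ on $(0,\infty)$ put $$\|g\|_{p,v}:=\Big(\int_0^\infty g(x)^p v(x)\,dx\Big)^{1/p},\qquad (S^*_u g)(t):=\operatorname*{ess\,sup}_{t\le\tau<\infty} g(\tau)u(\tau),\qquad \underline U(x):=\sup_{x\le \tau<\infty}\frac{u(\tau)^p}{V(\tau)^2},$$ and use the conventions $0\cdot\infty=0$ and $a/\infty=0$ for $0\le a\le\infty$. Consider the inequality $$\|S^*_u f\|_{q,w}\le c\,\|f\|_{p,v}\qquad\text{for all nonnegative non-increasing } f \text{ on } (0,\infty),\tag{1}$$ and let $c_*\in[0,\infty]$ be its best constant, i.e. the infimum of the finite $c\ge0$ for which (1) holds ($c_*=\infty$ if there is none). Put $T:=\|S^*_u\mathbf 1\|_{q,w}/\|\mathbf 1\|_{p,v}$. (i) If $p\le q$, then (1) holds for some finite $c$ if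 and only if $A_1+T<\infty$, and $c_*\approx A_1+T$, where $$A_1:=\sup_{x>0}\Big(\underline U(x)^{q/p}\,W(x)+\int_x^\infty \underline U(t)^{q/p}w(t)\,dt\Big)^{1/q}V(x)^{1/p}.$$ (ii) If $q<p$ and $1/r:=1/q-1/p$, then (1) holds for some finite $c$ if and only if $B_1+B_2+T<\infty$, and $c_*\approx B_1+B_2+T$, where $$B_1:=\Big(\int_0^\infty\Big(\int_x^\infty \underline U(t)^{q/p}w(t)\,dt\Big)^{r/p}V(x)^{r/p}\,\underline U(x)^{q/p}\,w(x)\,dx\Big)^{1/r},$$ $$B_2:=\Big(\int_0^\infty W(x)^{r/p}\Big[\sup_{x\le\tau<\infty}\underline U(\tau)V(\tau)\Big]^{r/p}w(x)\,dx\Big)^{1/r}.$$ Here $\approx$ means that each side is at most a constant multiple of the other (both possibly being $\infty$), with a positive finite constant depending only on $p$ and $q$. -/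

import Mathlib

open Set MeasureTheory
open scoped NNReal ENNReal

namespace SupremalOp

/-- A weight on `(0,∞)`: a nonnegative Lebesgue measurable function which is locally integrable
on `(0,∞)`. Functions on `(0,∞)` are represented by functions on `ℝ`, of which only the values on
`(0,∞)` are ever used. -/
structure IsWeight (w : ℝ → ℝ≥0∞) : Prop where
  aemeasurable : AEMeasurable w (volume.restrict (Ioi 0))
  locallyIntegrable : ∀ K : Set ℝ, IsCompact K → K ⊆ Ioi 0 → ∫⁻ x in K, w x < ∞

/-- The primitive `V(x) = ∫₀ˣ v`. -/
noncomputable def primitive (v : ℝ → ℝ≥0∞) (x : ℝ) : ℝ≥0∞ :=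
  ∫⁻ t in Ioc 0 x, v t

/-- The functional `‖g‖_{p,w,(0,∞)} = (∫₀^∞ g(x)^p w(x) dx)^{1/p}` for `0 < p < ∞`. -/
noncomputable def wnorm (p : ℝ) (w g : ℝ → ℝ≥0∞) : ℝ≥0∞ :=
  (∫⁻ x in Ioi 0, g x ^ p * w x) ^ (1 / p)

/-- The supremal operator `S* g(t) = ess sup_{t ≤ τ < ∞} g(τ)`. -/
noncomputable def supStar (g : ℝ → ℝ≥0∞) (t : ℝ) : ℝ≥0∞ :=
  essSup g (volume.restrict (Ici t))

/-- The operator `S*_u g = S*(g u)`. -/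
noncomputable def supStarU (u : ℝ → ℝ≥0) (g : ℝ → ℝ≥0∞) : ℝ → ℝ≥0∞ :=
  supStar fun τ => g τ * u τ

/-- `‖S*_u f‖_{q,w} ≤ c ‖f‖_{p,v}` for every nonnegative non-increasing `f` on `(0,∞)`. -/
def RestrictedIneq (p q : ℝ) (u : ℝ → ℝ≥0) (v w : ℝ → ℝ≥0∞) (c : ℝ≥0) : Prop :=
  ∀ f : ℝ → ℝ≥0∞, AntitoneOn f (Ioi 0) → wnorm q w (supStarU u f) ≤ c * wnorm p v f

/-- The best constant in the restricted inequality: the infimum of the admissible finite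
constants, which is `∞` when there is none. -/
noncomputable def bestConst (p q : ℝ) (u : ℝ → ℝ≥0) (v w : ℝ → ℝ≥0∞) : ℝ≥0∞ :=
  ⨅ (c : ℝ≥0) (_ : RestrictedIneq p q u v w c), (c : ℝ≥0∞)

/-- `sup_{x ≤ τ < ∞} u(τ)^p / V(τ)^2`. -/
noncomputable def envelope (p : ℝ) (u : ℝ → ℝ≥0) (v : ℝ → ℝ≥0∞) (x : ℝ) : ℝ≥0∞ :=
  ⨆ τ ∈ Ici x, (u τ : ℝ≥0∞) ^ p / primitive v τ ^ 2

/-- The test term `‖S*_u 1‖_{q,w} / ‖1‖_{p,v}`; note `a / ∞ = 0` for all `a`, also `a = ∞`. -/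
noncomputable def testTerm (p q : ℝ) (u : ℝ → ℝ≥0) (v w : ℝ → ℝ≥0∞) : ℝ≥0∞ :=
  wnorm q w (supStarU u fun _ => 1) / wnorm p v fun _ => 1

/-- The constant `A₁` of the case `p ≤ q`. -/
noncomputable def constA₁ (p q : ℝ) (u : ℝ → ℝ≥0) (v w : ℝ → ℝ≥0∞) : ℝ≥0∞ :=
  ⨆ x ∈ Ioi (0 : ℝ),
    (envelope p u v x ^ (q / p) * primitive w x
      + ∫⁻ t in Ioi x, envelope p u v t ^ (q / p) * w t) ^ (1 / q)
    * primitive v x ^ (1 / p)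

/-- The exponent `r` given by `1/r = 1/q - 1/p`, for `q < p`. -/
noncomputable def expR (p q : ℝ) : ℝ := (1 / q - 1 / p)⁻¹

/-- The constant `B₁` of the case `q < p`. -/
noncomputable def constB₁ (p q : ℝ) (u : ℝ → ℝ≥0) (v w : ℝ → ℝ≥0∞) : ℝ≥0∞ :=
  (∫⁻ x in Ioi 0,
    (∫⁻ t in Ioi x, envelope p u v t ^ (q / p) * w t) ^ (expR p q / p)
      * primitive v x ^ (expR p q / p) * envelope p u v x ^ (q / p) * w x) ^ (1 / expR p q)

/-- The constant `B₂` of the case `q < p`. -/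
noncomputable def constB₂ (p q : ℝ) (u : ℝ → ℝ≥0) (v w : ℝ → ℝ≥0∞) : ℝ≥0∞ :=
  (∫⁻ x in Ioi 0,
    primitive w x ^ (expR p q / p)
      * (⨆ τ ∈ Ici x, envelope p u v τ * primitive v τ) ^ (expR p q / p) * w x)
    ^ (1 / expR p q)

end SupremalOp

/-! Put `g = f ^ p`, `φ = u ^ p`, `s = q / p`, and let `μ`, `ν` be the measures with densities `w`,
`v`. The inequality becomes `∫ (S* (g φ)) ^ s dμ ≤ K (∫ g dν) ^ s` for non-increasing `g`
(`PowerIneq`). Write `V` for the primitive of `ν` and `U` for the least non-increasing majorant of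
`φ / V ^ 2`.

Non-increasing functions can be replaced by point masses. Sampling `g` at one point `y k` of each
dyadic level of `V`, with `a k = g (y k) * 2 ^ k`, gives `∑ a k ≤ 2 ∫ g dν` and `S* (g φ) t ≤ 16
sup_k a k * V (y k) * U (max t (y k))` (`exists_supStar_le`). Conversely, the kernels `V y / V (max
τ y) ^ 2` are non-increasing in `τ`, have `ν`-integral at most `5`, and are mapped by `S* (· φ)` to
at least `V y * U (max t y)`. So the inequality is equivalent to one for sequences of points and
masses.

For `s ≥ 1` a single point suffices, because `∑ a k ^ s ≤ (∑ a k) ^ s`; this is `A₁`. For `s < 1`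
the supremum is split into `y k ≤ t`, governed by the measure `U ^ s dμ` and its tail, and `y k ≥
t`, governed by `μ` and its primitive. Both parts are instances of one supremal Hardy inequality,
proved by Hölder's inequality over dyadic levels (`lintegral_iSup_rpow_le`) and reversed by masses
that saturate Hölder (`hardyInt_rpow_le`); they give `B₁` and `B₂`.

The term `T` plays no role in sufficiency. It is bounded by every admissible constant, by testing
with `f = 1`, so adding it preserves the equivalence. -/

namespace SupremalOp

/-! ### Dyadic levels -/

/-- The dyadic number `2 ^ i`. -/
noncomputable def dyadic (i : ℤ) : ℝ≥0∞ := 2 ^ (i : ℝ)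

lemma dyadic_ne_zero (i : ℤ) : dyadic i ≠ 0 :=
  (ENNReal.rpow_pos (by norm_num) (by norm_num)).ne'

lemma dyadic_ne_top (i : ℤ) : dyadic i ≠ ∞ :=
  ENNReal.rpow_ne_top_of_ne_zero (by norm_num) (by norm_num)

lemma dyadic_succ (i : ℤ) : dyadic (i + 1) = 2 * dyadic i := by
  rw [dyadic, Int.cast_add, ENNReal.rpow_add _ _ (by simp) (by simp), Int.cast_one,
    ENNReal.rpow_one, mul_comm, dyadic]

lemma dyadic_pred (i : ℤ) : dyadic i = 2 * dyadic (i - 1) := by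
  rw [← dyadic_succ, sub_add_cancel]

lemma dyadic_mono {i j : ℤ} (h : i ≤ j) : dyadic i ≤ dyadic j :=
  ENNReal.rpow_le_rpow_of_exponent_le (by norm_num) (by exact_mod_cast h)

lemma exists_dyadic {x : ℝ≥0∞} (h0 : x ≠ 0) (h1 : x ≠ ∞) :
    ∃ i, dyadic i ≤ x ∧ x < dyadic (i + 1) := by
  obtain ⟨n, hn⟩ := ENNReal.exists_mem_Ico_zpow h0 h1 (y := 2) (by norm_num) (by simp)
  refine ⟨n, ?_⟩
  simp only [dyadic, ENNReal.rpow_intCast]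
  exact hn

/-- The set where `W` lies between two consecutive dyadic numbers. -/
def level {X : Type*} (W : X → ℝ≥0∞) (i : ℤ) : Set X := {x | dyadic i ≤ W x ∧ W x < dyadic (i + 1)}

section level

variable {X : Type*} {W : X → ℝ≥0∞}

lemma level_index_lt {i j : ℤ} {x y : X} (hx : x ∈ level W i) (hy : y ∈ level W j)
    (h : i < j) : W x < W y :=
  hx.2.trans_le ((dyadic_mono (by lia)).trans hy.1)

lemma pairwise_disjoint_level : Pairwise (Function.onFun Disjoint (level W)) := by
  intro i j hij
  rw [Function.onFun, Set.disjoint_left]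
  intro x hx hy
  rcases lt_or_gt_of_ne hij with h | h
  · exact lt_irrefl _ (level_index_lt hx hy h)
  · exact lt_irrefl _ (level_index_lt hy hx h)

variable [MeasurableSpace X] {m : Measure X}

lemma measurableSet_level (hW : Measurable W) (i : ℤ) : MeasurableSet (level W i) :=
  (measurableSet_le measurable_const hW).inter (measurableSet_lt hW measurable_const)

/-- The level is a difference of two sublevel sets, of measure at least `2 ^ (i + 1)` and at most `2
^ i`. This lets a dyadic number be exchanged for an integral over a level. -/
lemma dyadic_le_measure_level (hle : ∀ r, m {x | W x < r} ≤ r)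
    {ρ : ℝ≥0∞} (hge : ∀ r ≤ ρ, r ≤ m {x | W x < r}) {i : ℤ} (hi : dyadic (i + 1) ≤ ρ) :
    dyadic i ≤ m (level W i) := by
  have h : {x | W x < dyadic (i + 1)} ⊆ level W i ∪ {x | W x < dyadic i} := by
    intro x hx
    rcases le_or_gt (dyadic i) (W x) with h | h
    · exact Or.inl ⟨h, hx⟩
    · exact Or.inr h
  have h2 : dyadic i + dyadic i ≤ m (level W i) + dyadic i := by
    calc dyadic i + dyadic i = dyadic (i + 1) := by rw [dyadic_succ, two_mul]
      _ ≤ m {x | W x < dyadic (i + 1)} := hge _ hi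
      _ ≤ m (level W i) + m {x | W x < dyadic i} := (measure_mono h).trans (measure_union_le _ _)
      _ ≤ _ := by gcongr; exact hle _
  exact (ENNReal.add_le_add_iff_right (dyadic_ne_top i)).1 h2

lemma tsum_setLIntegral_level_le (hW : Measurable W) (f : X → ℝ≥0∞) :
    ∑' i, ∫⁻ x in level W i, f x ∂m ≤ ∫⁻ x, f x ∂m := by
  rw [← lintegral_iUnion (measurableSet_level hW) pairwise_disjoint_level]
  exact setLIntegral_le_lintegral _ _

lemma mul_measure_le_setLIntegral {s : Set X} (hs : MeasurableSet s) {f : X → ℝ≥0∞}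
    {c : ℝ≥0∞} (h : ∀ x ∈ s, c ≤ f x) : c * m s ≤ ∫⁻ x in s, f x ∂m := by
  rw [← setLIntegral_const]
  exact setLIntegral_mono' hs h

end level

/-! ### Distribution of the primitive of a measure without atoms -/

/-- The sublevel set is a lower set: either it has a greatest element, or it lies in a countable
directed union of rational half-lines, each of measure less than `r`. Atoms do no harm in this
direction. -/
lemma measure_primitive_lt_le (m : Measure ℝ) (r : ℝ≥0∞) : m {x | m (Iic x) < r} ≤ r := by
  set A := {x | m (Iic x) < r} with hA
  have hlow : ∀ x ∈ A, ∀ y ≤ x, y ∈ A := fun x hx y hy =>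
    (measure_mono (Iic_subset_Iic.2 hy)).trans_lt hx
  by_cases hmax : ∃ b ∈ A, ∀ x ∈ A, x ≤ b
  · obtain ⟨b, hb, hmax⟩ := hmax
    exact (measure_mono (fun x hx => hmax x hx)).trans (le_of_lt hb)
  · push Not at hmax
    have hU : A ⊆ ⋃ c ∈ {c : ℚ | (c : ℝ) ∈ A}, Iic (c : ℝ) := by
      intro x hx
      obtain ⟨y, hy, hxy⟩ := hmax x hx
      obtain ⟨c, hc, hc'⟩ := exists_rat_btwn hxy
      simp only [mem_iUnion]
      exact ⟨c, hlow y hy _ hc'.le, hc.le⟩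
    refine (measure_mono hU).trans ?_
    rw [measure_biUnion_eq_iSup (Set.to_countable _)]
    · exact iSup₂_le fun c hc => le_of_lt hc
    · intro a ha b hb
      rcases le_total a b with h | h
      · exact ⟨b, hb, Iic_subset_Iic.2 (by exact_mod_cast h), subset_rfl⟩
      · exact ⟨a, ha, subset_rfl, Iic_subset_Iic.2 (by exact_mod_cast h)⟩

lemma tendsto_primitive_right (m : Measure ℝ) {b x : ℝ} (hbx : b < x) (hx : m (Iic x) ≠ ∞) :
    Filter.Tendsto (fun y => m (Iic y)) (nhdsWithin b (Ioi b)) (nhds (m (Iic b))) := by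
  have ht := tendsto_measure_biInter_gt (μ := m) (s := Iic) (a := b)
    (fun r _ => measurableSet_Iic.nullMeasurableSet) (fun i j _ h => Iic_subset_Iic.2 h)
    ⟨x, hbx, hx⟩
  have he : (⋂ r, ⋂ (_ : r > b), Iic r) = Iic b := by
    ext y
    simp only [mem_iInter, mem_Iic]
    exact ⟨fun h => le_of_forall_gt_imp_ge_of_dense h, fun h r hr => h.trans hr.le⟩
  rwa [he] at ht

/-- With `b` the infimum of the complement of the sublevel set, right continuity of the primitive
gives `r ≤ m (Iic b)`. Absence of atoms replaces `Iic b` by `Iio b`, which lies in the sublevel set.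
-/
lemma le_measure_primitive_lt (m : Measure ℝ) [NullSingletonClass m] {x : ℝ} (hx : m (Iic x) ≠ ∞)
    {r : ℝ≥0∞} (hr : r ≤ m (Iic x)) : r ≤ m {y | m (Iic y) < r} := by
  rcases eq_or_ne r 0 with rfl | hr0
  · exact zero_le
  set A := {y | m (Iic y) < r} with hA
  have hlow : ∀ a ∈ A, ∀ y ≤ a, y ∈ A := fun a ha y hy =>
    (measure_mono (Iic_subset_Iic.2 hy)).trans_lt ha
  -- The primitive tends to `0` at `-∞`; this bounds the complement of `A` from below, so that its
  -- infimum is meaningful.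
  have hne : ∃ a, a ∈ A := by
    have ht : Filter.Tendsto (m ∘ fun n : ℕ => Iic (x - n)) Filter.atTop
        (nhds (m (⋂ n : ℕ, Iic (x - n)))) :=
      tendsto_measure_iInter_atTop (fun n => measurableSet_Iic.nullMeasurableSet)
        (fun a b h => Iic_subset_Iic.2 (by gcongr)) ⟨0, by simpa using hx⟩
    have he : (⋂ n : ℕ, Iic (x - n)) = ∅ := by
      ext y
      simp only [mem_iInter, mem_Iic, mem_empty_iff_false, iff_false, not_forall, not_le]
      obtain ⟨n, hn⟩ := exists_nat_gt (x - y)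
      exact ⟨n, by linarith⟩
    rw [he, measure_empty] at ht
    obtain ⟨n, hn⟩ := ((tendsto_order.1 ht).2 r (pos_iff_ne_zero.2 hr0)).exists
    exact ⟨_, hn⟩
  obtain ⟨a, ha⟩ := hne
  have hxA : x ∈ Aᶜ := not_lt.2 hr
  have hbdd : BddBelow Aᶜ := ⟨a, fun y hy => le_of_not_ge fun h => hy (hlow a ha y h)⟩
  set b := sInf Aᶜ
  have hbx : b ≤ x := csInf_le hbdd hxA
  have hIio : Iio b ⊆ A := fun y hy => by
    by_contra h
    exact absurd (csInf_le hbdd h) (not_le.2 hy)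
  have hb : r ≤ m (Iic b) := by
    rcases hbx.eq_or_lt with h | h
    · rwa [h]
    · refine ge_of_tendsto (tendsto_primitive_right m h hx) ?_
      filter_upwards [self_mem_nhdsWithin] with y hy
      obtain ⟨z, hz, hzy⟩ := exists_lt_of_csInf_lt ⟨x, hxA⟩ hy
      have hz' : r ≤ m (Iic z) := not_lt.1 fun h => hz h
      exact hz'.trans (measure_mono (Iic_subset_Iic.2 hzy.le))
  exact hb.trans (by rw [← measure_congr Iio_ae_eq_Iic]; exact measure_mono hIio)

lemma map_neg_Iic (m : Measure ℝ) [NullSingletonClass m] (x : ℝ) :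
    m.map Neg.neg (Iic x) = m (Ioi (-x)) := by
  rw [Measure.map_apply measurable_neg measurableSet_Iic]
  have : (Neg.neg ⁻¹' Iic x : Set ℝ) = Ici (-x) := by
    ext y; simp only [mem_preimage, mem_Iic, mem_Ici]; constructor <;> intro h <;> linarith
  rw [this, ← measure_congr Ioi_ae_eq_Ici]

/-- Reflection turns tails into primitives, so both distribution bounds carry over. -/
lemma measure_tail_lt (m : Measure ℝ) [NullSingletonClass m] (r : ℝ≥0∞) :
    m {x | m (Ioi x) < r} = m.map Neg.neg {x | m.map Neg.neg (Iic x) < r} := by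
  rw [(MeasurableEquiv.neg ℝ).measurableEmbedding.map_apply (f := Neg.neg) m]
  simp [map_neg_Iic]

lemma nullSingletonClass_map_neg (m : Measure ℝ) [NullSingletonClass m] : NullSingletonClass (m.map Neg.neg) := by
  refine ⟨fun x => ?_⟩
  rw [Measure.map_apply measurable_neg (measurableSet_singleton x)]
  simp

lemma measure_tail_lt_le (m : Measure ℝ) [NullSingletonClass m] (r : ℝ≥0∞) :
    m {x | m (Ioi x) < r} ≤ r := by
  rw [measure_tail_lt]
  exact measure_primitive_lt_le _ r

lemma le_measure_tail_lt (m : Measure ℝ) [NullSingletonClass m] {x : ℝ} (hx : m (Ioi x) ≠ ∞)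
    {r : ℝ≥0∞} (hr : r ≤ m (Ioi x)) : r ≤ m {y | m (Ioi y) < r} := by
  have := nullSingletonClass_map_neg m
  rw [measure_tail_lt]
  refine le_measure_primitive_lt (x := -x) _ ?_ ?_ <;> rwa [map_neg_Iic, neg_neg]

lemma measurable_primitive (m : Measure ℝ) : Measurable fun x => m (Iic x) :=
  Monotone.measurable fun _ _ h => measure_mono (Iic_subset_Iic.2 h)

lemma measurable_tail (m : Measure ℝ) : Measurable fun x => m (Ioi x) :=
  Antitone.measurable fun _ _ h => measure_mono (Ioi_subset_Ioi h)

/-! ### A supremal Hardy inequality for exponents below one, and its converse -/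

lemma tsum_rpow_mul_rpow_le {ι : Type*} (f g : ι → ℝ≥0∞) {s : ℝ} (hs0 : 0 < s) (hs1 : s < 1) :
    ∑' i, f i ^ s * g i ^ (1 - s) ≤ (∑' i, f i) ^ s * (∑' i, g i) ^ (1 - s) := by
  let _ : MeasurableSpace ι := ⊤
  have := ENNReal.lintegral_mul_norm_pow_le (μ := Measure.count) (f := f) (g := g)
    measurable_from_top.aemeasurable measurable_from_top.aemeasurable hs0.le
    (sub_pos.2 hs1).le (by ring)
  simpa only [lintegral_count] using this

lemma rpow_iSup_le_tsum {ι : Type*} (f : ι → ℝ≥0∞) {s : ℝ} (hs : 0 < s) :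
    (⨆ k, f k) ^ s ≤ ∑' k, f k ^ s := by
  rw [← ENNReal.le_rpow_inv_iff hs]
  exact iSup_le fun k => (ENNReal.le_rpow_inv_iff hs).2 (ENNReal.le_tsum k)

lemma rpow_iSup_le {ι : Sort*} {f : ι → ℝ≥0∞} {s : ℝ} (hs : 0 < s) {c : ℝ≥0∞}
    (h : ∀ k, f k ^ s ≤ c) : (⨆ k, f k) ^ s ≤ c := by
  rw [← ENNReal.le_rpow_inv_iff hs]
  exact iSup_le fun k => (ENNReal.le_rpow_inv_iff hs).2 (h k)

variable {X : Type*} [MeasurableSpace X] {m : Measure X} {W Z : X → ℝ≥0∞} {s : ℝ}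

/-- The integral of `W ^ R * Z ^ R` with `R = s / (1 - s)`, which governs the inequality below. -/
noncomputable def hardyInt (m : Measure X) (W Z : X → ℝ≥0∞) (s : ℝ) : ℝ≥0∞ :=
  ∫⁻ x, W x ^ (s / (1 - s)) * Z x ^ (s / (1 - s)) ∂m

lemma dyadic_mul_rpow (hs1 : s < 1) (i : ℤ) :
    dyadic i ^ (s / (1 - s)) * dyadic i = dyadic i ^ (1 / (1 - s)) := by
  have h : 1 / (1 - s) = s / (1 - s) + 1 := by
    have : 1 - s ≠ 0 := by linarith
    field_simp; ring
  rw [h, ENNReal.rpow_add _ _ (dyadic_ne_zero i) (dyadic_ne_top i), ENNReal.rpow_one]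

/-- Hölder with exponents `1 / s` and `1 / (1 - s)`, the weight `e` being put entirely into the
second factor. -/
lemma mul_rpow_le_tsum (hs0 : 0 < s) (hs1 : s < 1) (e α ζ : ℤ → ℝ≥0∞) :
    ∑' i, e i * (α i * ζ i) ^ s
      ≤ (∑' i, α i) ^ s * (∑' i, e i ^ (1 / (1 - s)) * ζ i ^ (s / (1 - s))) ^ (1 - s) := by
  have h1 : 0 < 1 - s := sub_pos.2 hs1
  refine le_trans (le_of_eq ?_) (tsum_rpow_mul_rpow_le _ _ hs0 hs1)
  congr 1; ext i
  rw [ENNReal.mul_rpow_of_nonneg _ _ hs0.le, ENNReal.mul_rpow_of_nonneg _ _ h1.le,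
    ← ENNReal.rpow_mul, ← ENNReal.rpow_mul, div_mul_cancel₀ _ h1.ne', div_mul_cancel₀ _ h1.ne',
    ENNReal.rpow_one]
  ring

/-- The indices are grouped by the dyadic level of `ρ k`. Group `i` acts only where `W < 2 ^ (i +
1)`, a set of measure at most `2 ^ (i + 1)`, so the integral is a dyadic sum to which Hölder
applies. The constant `4` is `2` from this doubling times `2` from moving down one level in `hζint`.
-/
theorem lintegral_iSup_rpow_le {ι : Type*} (hs0 : 0 < s) (hs1 : s < 1) (hW : Measurable W)
    (hle : ∀ r, m {x | W x < r} ≤ r) {a b ρ : ι → ℝ≥0∞} (hρ : ∀ k, ρ k ≠ ∞)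
    (hge : ∀ k, ∀ r ≤ ρ k, r ≤ m {x | W x < r}) (hbZ : ∀ k x, W x < ρ k → b k ≤ Z x) :
    ∫⁻ t, (⨆ k, ⨆ (_ : W t ≤ ρ k), a k * b k) ^ s ∂m
      ≤ 4 * ((∑' k, a k) ^ s * hardyInt m W Z s ^ (1 - s)) := by
  have h1 : 0 < 1 - s := sub_pos.2 hs1
  have hR : 0 < s / (1 - s) := by positivity
  set K : ℤ → ι → Prop := fun i k => dyadic i ≤ ρ k ∧ ρ k < dyadic (i + 1) with hK
  set α : ℤ → ℝ≥0∞ := fun i => ⨆ k, ⨆ (_ : K i k), a k with hα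
  set ζ : ℤ → ℝ≥0∞ := fun i => ⨆ k, ⨆ (_ : K i k), b k with hζ
  have hαsum : ∑' i, α i ≤ ∑' k, a k := by
    calc ∑' i, α i ≤ ∑' i, ∑' k, (level ρ i).indicator a k := by
          refine ENNReal.tsum_le_tsum fun i => iSup₂_le fun k hk => ?_
          refine le_trans (le_of_eq ?_) (ENNReal.le_tsum k)
          exact (indicator_of_mem (s := level ρ i) hk a).symm
      _ = ∑' k, ∑' i, (level ρ i).indicator a k := ENNReal.tsum_comm
      _ ≤ ∑' k, a k := by
          refine ENNReal.tsum_le_tsum fun k => ?_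
          by_cases h : ∃ i, k ∈ level ρ i
          · obtain ⟨i, hi⟩ := h
            rw [tsum_eq_single i, indicator_of_mem hi]
            intro j hj
            refine indicator_of_notMem (fun h => ?_) _
            exact Set.disjoint_left.1 (pairwise_disjoint_level hj) h hi
          · push Not at h
            simp [indicator_of_notMem (h _)]
  have hpt : ∀ᵐ t ∂m, (⨆ k, ⨆ (_ : W t ≤ ρ k), a k * b k) ^ s
      ≤ ∑' i, ({x | W x < dyadic (i + 1)}.indicator fun _ => (α i * ζ i) ^ s) t := by
    -- Outside this null set, `W t ≤ ρ k` forces `ρ k ≠ 0`, so `ρ k` has a dyadic level.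
    have h0 : ∀ᵐ t ∂m, W t ≠ 0 := by
      refine measure_mono_null (t := ⋂ n : ℕ, {x | W x < (n + 1 : ℝ≥0∞)⁻¹}) ?_ ?_
      · intro x hx
        have hx : W x = 0 := by simpa using hx
        simp [hx]
      · refine le_antisymm (le_of_forall_gt fun r hr => ?_) zero_le
        obtain ⟨n, hn⟩ := ENNReal.exists_inv_nat_lt hr.ne'
        refine lt_of_le_of_lt ((measure_mono (iInter_subset _ n)).trans (hle _)) (lt_of_le_of_lt ?_ hn)
        exact ENNReal.inv_le_inv.2 (by simp)
    filter_upwards [h0] with t ht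
    refine rpow_iSup_le hs0 fun k => rpow_iSup_le hs0 fun hk => ?_
    obtain ⟨i, hi⟩ := exists_dyadic (ne_bot_of_le_ne_bot ht hk) (hρ k)
    refine le_trans ?_ (ENNReal.le_tsum i)
    rw [indicator_of_mem (show t ∈ {x | W x < dyadic (i + 1)} from hk.trans_lt hi.2)]
    gcongr
    · exact le_iSup₂_of_le k hi le_rfl
    · exact le_iSup₂_of_le k hi le_rfl
  -- On level `i - 1` one has `W x < 2 ^ i ≤ ρ k`, hence `b k ≤ Z x` for every `k` in group `i`;
  -- that level has measure at least `2 ^ (i - 1)`.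
  have hζint : ∀ i, dyadic i ^ (1 / (1 - s)) * ζ i ^ (s / (1 - s))
      ≤ 2 ^ (1 / (1 - s)) * ∫⁻ x in level W (i - 1),
          W x ^ (s / (1 - s)) * Z x ^ (s / (1 - s)) ∂m := by
    intro i
    have h2 : dyadic i ^ (1 / (1 - s)) = 2 ^ (1 / (1 - s)) * dyadic (i - 1) ^ (1 / (1 - s)) := by
      rw [dyadic_pred, ENNReal.mul_rpow_of_nonneg _ _ (by positivity)]
    rw [h2, mul_assoc]
    gcongr
    have hd0 : dyadic (i - 1) ^ (1 / (1 - s)) ≠ 0 := by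
      simp [ENNReal.rpow_eq_zero_iff, dyadic_ne_zero, dyadic_ne_top]
    have hdt : dyadic (i - 1) ^ (1 / (1 - s)) ≠ ∞ :=
      ENNReal.rpow_ne_top_of_nonneg (by positivity) (dyadic_ne_top _)
    rw [mul_comm, ← ENNReal.le_div_iff_mul_le (Or.inl hd0) (Or.inl hdt)]
    refine rpow_iSup_le hR fun k => rpow_iSup_le hR fun hk => ?_
    rw [ENNReal.le_div_iff_mul_le (Or.inl hd0) (Or.inl hdt), ← dyadic_mul_rpow hs1]
    calc b k ^ (s / (1 - s)) * (dyadic (i - 1) ^ (s / (1 - s)) * dyadic (i - 1))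
        = (dyadic (i - 1) ^ (s / (1 - s)) * b k ^ (s / (1 - s))) * dyadic (i - 1) := by ring
      _ ≤ (dyadic (i - 1) ^ (s / (1 - s)) * b k ^ (s / (1 - s))) * m (level W (i - 1)) := by
          gcongr
          exact dyadic_le_measure_level hle (hge k) (by simpa using hk.1)
      _ ≤ _ := by
          refine mul_measure_le_setLIntegral (measurableSet_level hW _) fun x hx => ?_
          gcongr
          · exact hx.1
          · exact hbZ k x (lt_of_lt_of_le hx.2 (by simpa using hk.1))
  calc ∫⁻ t, (⨆ k, ⨆ (_ : W t ≤ ρ k), a k * b k) ^ s ∂m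
      ≤ ∫⁻ t, ∑' i, ({x | W x < dyadic (i + 1)}.indicator fun _ => (α i * ζ i) ^ s) t ∂m :=
        lintegral_mono_ae hpt
    _ = ∑' i, (α i * ζ i) ^ s * m {x | W x < dyadic (i + 1)} := by
        rw [lintegral_tsum fun i => (measurable_const.indicator
          (measurableSet_lt hW measurable_const)).aemeasurable]
        congr 1; ext i
        rw [lintegral_indicator_const (measurableSet_lt hW measurable_const)]
    _ ≤ ∑' i, 2 * (dyadic i * (α i * ζ i) ^ s) := by
        refine ENNReal.tsum_le_tsum fun i => ?_
        rw [← mul_assoc, ← dyadic_succ, mul_comm]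
        gcongr
        exact hle _
    _ = 2 * ∑' i, dyadic i * (α i * ζ i) ^ s := ENNReal.tsum_mul_left
    _ ≤ 2 * ((∑' i, α i) ^ s
          * (∑' i, dyadic i ^ (1 / (1 - s)) * ζ i ^ (s / (1 - s))) ^ (1 - s)) := by
        gcongr
        exact mul_rpow_le_tsum hs0 hs1 _ _ _
    _ ≤ 2 * ((∑' k, a k) ^ s * (2 ^ (1 / (1 - s)) * hardyInt m W Z s) ^ (1 - s)) := by
        gcongr
        refine (ENNReal.tsum_le_tsum hζint).trans ?_
        rw [ENNReal.tsum_mul_left]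
        gcongr
        rw [← (Equiv.addRight (1 : ℤ)).tsum_eq]
        simpa [hardyInt] using tsum_setLIntegral_level_le (m := m) hW
          fun x => W x ^ (s / (1 - s)) * Z x ^ (s / (1 - s))
    _ = 4 * ((∑' k, a k) ^ s * hardyInt m W Z s ^ (1 - s)) := by
        rw [ENNReal.mul_rpow_of_nonneg _ _ h1.le, ← ENNReal.rpow_mul, div_mul_cancel₀ _ h1.ne',
          ENNReal.rpow_one]
        ring

/-- A sum bounded by a multiple of a lower power of itself. -/
lemma rpow_one_sub_le_of_le_mul_rpow {S A : ℝ≥0∞} (hS : S ≠ ∞) (hs1 : s < 1)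
    (h : S ≤ A * S ^ s) : S ^ (1 - s) ≤ A := by
  rcases eq_or_ne S 0 with rfl | h0
  · simp [ENNReal.zero_rpow_of_pos (sub_pos.2 hs1)]
  rw [ENNReal.rpow_sub _ _ h0 hS, ENNReal.rpow_one]
  exact ENNReal.div_le_of_le_mul h

/-- The masses `c i` are those giving equality in Hölder: they satisfy `2 ^ i * (c i * M i) ^ s = c
i`. Testing with them bounds `∑ c i` by `4 * K * (∑ c i) ^ s`, and finite partial sums allow
division. The hypothesis is tested with strict `W t < W (y j)`, so that for a primitive or a tail it
fixes the order of `t` and `y j` on the line. -/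
theorem hardyInt_rpow_le [Nonempty X] (hs0 : 0 < s) (hs1 : s < 1) (hW : Measurable W)
    (hle : ∀ r, m {x | W x < r} ≤ r) {P : Set X} (hWP : ∀ᵐ x ∂m, W x ≠ ∞)
    (hge : ∀ x ∈ P, ∀ r ≤ W x, r ≤ m {x | W x < r}) {z : X → ℝ≥0∞}
    (hZ : ∀ᵐ x ∂m, Z x ≤ ⨆ y ∈ P, ⨆ (_ : W x ≤ W y), z y) {K : ℝ≥0∞}
    (hK : ∀ (J : Finset ℤ) (y : ℤ → X) (c : ℤ → ℝ≥0∞), (∀ j ∈ J, y j ∈ P) →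
      ∫⁻ t, (⨆ j ∈ J, ⨆ (_ : W t < W (y j)), c j * z (y j)) ^ s ∂m ≤ K * (∑ j ∈ J, c j) ^ s) :
    hardyInt m W Z s ^ (1 - s) ≤ 8 * K := by
  have h1 : 0 < 1 - s := sub_pos.2 hs1
  have hR : 0 < s / (1 - s) := by positivity
  have hQ : 0 < 1 / (1 - s) := by positivity
  rcases eq_or_ne K ∞ with rfl | hKt
  · simp
  set M : ℤ → ℝ≥0∞ := fun i => ⨆ y ∈ P, ⨆ (_ : dyadic i ≤ W y), z y with hM
  -- A single unit mass at `y` gives `z y ^ s * 2 ^ (i - 1) ≤ K`.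
  have hMt : ∀ i, M i ≠ ∞ := by
    intro i
    have hb : M i ≤ (K / dyadic (i - 1)) ^ s⁻¹ := by
      refine iSup₂_le fun y hy => iSup_le fun hyi => ?_
      rw [ENNReal.le_rpow_inv_iff hs0,
        ENNReal.le_div_iff_mul_le (Or.inl (dyadic_ne_zero _)) (Or.inl (dyadic_ne_top _))]
      have := hK {i} (fun _ => y) (fun _ => 1) (fun _ _ => hy)
      simp only [Finset.mem_singleton, iSup_iSup_eq_left, one_mul, Finset.sum_singleton,
        ENNReal.one_rpow, mul_one] at this
      refine le_trans ?_ ((setLIntegral_le_lintegral (level W (i - 1)) _).trans this)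
      calc z y ^ s * dyadic (i - 1) ≤ z y ^ s * m (level W (i - 1)) := by
            gcongr
            exact dyadic_le_measure_level hle (hge y hy) (by simpa using hyi)
        _ ≤ _ := by
            refine mul_measure_le_setLIntegral (measurableSet_level hW _) fun x hx => ?_
            gcongr
            exact le_iSup_of_le (lt_of_lt_of_le hx.2 (by simpa using hyi)) le_rfl
    refine ne_top_of_le_ne_top (ENNReal.rpow_ne_top_of_nonneg (by positivity) ?_) hb
    exact ENNReal.div_ne_top hKt (dyadic_ne_zero _)
  set c : ℤ → ℝ≥0∞ := fun i => dyadic i ^ (1 / (1 - s)) * M i ^ (s / (1 - s)) with hc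
  have hct : ∀ i, c i ≠ ∞ := fun i => ENNReal.mul_ne_top
    (ENNReal.rpow_ne_top_of_nonneg hQ.le (dyadic_ne_top i))
    (ENNReal.rpow_ne_top_of_nonneg hR.le (hMt i))
  have hcM : ∀ i, M i ≠ 0 → dyadic i * (c i * M i) ^ s = c i := by
    intro i hi
    have e1 : dyadic i * (dyadic i ^ (1 / (1 - s))) ^ s = dyadic i ^ (1 / (1 - s)) := by
      rw [← ENNReal.rpow_mul]
      nth_rw 1 [← ENNReal.rpow_one (dyadic i)]
      rw [← ENNReal.rpow_add _ _ (dyadic_ne_zero i) (dyadic_ne_top i)]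
      congr 1; field_simp; ring
    have e2 : (M i ^ (s / (1 - s))) ^ s * M i ^ s = M i ^ (s / (1 - s)) := by
      rw [← ENNReal.rpow_mul, ← ENNReal.rpow_add _ _ hi (hMt i)]
      congr 1; field_simp; ring
    calc dyadic i * (c i * M i) ^ s
        = (dyadic i * (dyadic i ^ (1 / (1 - s))) ^ s)
          * ((M i ^ (s / (1 - s))) ^ s * M i ^ s) := by
          rw [hc, ENNReal.mul_rpow_of_nonneg _ _ hs0.le, ENNReal.mul_rpow_of_nonneg _ _ hs0.le]
          ring
      _ = c i := by rw [e1, e2]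
  have hfin : ∀ J : Finset ℤ, (∑ j ∈ J, c j) ^ (1 - s) ≤ 4 * K := by
    intro J
    -- Where `M j = 0` the mass `c j` vanishes, while no point need come within a factor `2` of the
    -- supremum.
    set J' := J.filter fun j => M j ≠ 0 with hJ'
    have hsum : ∑ j ∈ J, c j = ∑ j ∈ J', c j := by
      refine (Finset.sum_filter_of_ne (p := fun j => M j ≠ 0) fun j _ hj h => hj ?_).symm
      simp only [hc, h, ENNReal.zero_rpow_of_pos hR, mul_zero]
    rw [hsum]
    have hy : ∀ j, ∃ y, M j ≠ 0 → y ∈ P ∧ dyadic j ≤ W y ∧ M j ≤ 2 * z y := by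
      intro j
      rcases eq_or_ne (M j) 0 with h | h
      · exact ⟨Classical.arbitrary X, fun h' => absurd h h'⟩
      · have : M j / 2 < M j := ENNReal.half_lt_self h (hMt j)
        simp only [hM, lt_iSup_iff] at this
        obtain ⟨y, hyP, hyj, hlt⟩ := this
        refine ⟨y, fun _ => ⟨hyP, hyj, ?_⟩⟩
        have := ENNReal.div_le_iff_le_mul (a := M j) (b := 2) (c := z y) (by simp) (by simp)
        rw [mul_comm]
        exact this.1 hlt.le
    choose y hy using hy
    have hJM : ∀ j ∈ J', M j ≠ 0 := fun j hj => (Finset.mem_filter.1 hj).2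
    have key := hK J' y c fun j hj => (hy j (hJM j hj)).1
    refine rpow_one_sub_le_of_le_mul_rpow (ENNReal.sum_ne_top.2 fun j _ => hct j) hs1 ?_
    rw [mul_assoc]
    refine le_trans ?_ (mul_le_mul_right key 4)
    have hle1 : ∑ j ∈ J', ∫⁻ t in level W (j - 1),
        (⨆ j ∈ J', ⨆ (_ : W t < W (y j)), c j * z (y j)) ^ s ∂m
        ≤ ∫⁻ t, (⨆ j ∈ J', ⨆ (_ : W t < W (y j)), c j * z (y j)) ^ s ∂m := by
      rw [← lintegral_biUnion_finset (t := fun j => level W (j - 1))]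
      · exact setLIntegral_le_lintegral _ _
      · intro i _ j _ hij
        exact pairwise_disjoint_level (by simpa using hij)
      · exact fun j _ => measurableSet_level hW _
    refine le_trans ?_ (mul_le_mul_right hle1 4)
    rw [Finset.mul_sum]
    refine Finset.sum_le_sum fun j hj => ?_
    obtain ⟨hyP, hyj, hyM⟩ := hy j (hJM j hj)
    have hyj' : dyadic (j - 1 + 1) ≤ W (y j) := by simpa using hyj
    calc c j = dyadic j * (c j * M j) ^ s := (hcM j (hJM j hj)).symm
      _ ≤ (2 * dyadic (j - 1)) * (c j * (2 * z (y j))) ^ s := by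
          rw [← dyadic_pred]; gcongr
      _ = 2 * 2 ^ s * ((c j * z (y j)) ^ s * dyadic (j - 1)) := by
          rw [mul_left_comm, ENNReal.mul_rpow_of_nonneg _ _ hs0.le]; ring
      _ ≤ 4 * ((c j * z (y j)) ^ s * m (level W (j - 1))) := by
          gcongr
          · calc (2 : ℝ≥0∞) * 2 ^ s ≤ 2 * 2 ^ (1 : ℝ) := by
                  gcongr; norm_num
              _ = 4 := by norm_num
          · exact dyadic_le_measure_level hle (hge _ hyP) hyj'
      _ ≤ _ := by
          gcongr
          refine mul_measure_le_setLIntegral (measurableSet_level hW _) fun x hx => ?_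
          gcongr
          exact le_iSup₂_of_le j hj (le_iSup_of_le (hx.2.trans_le hyj') le_rfl)
  have hpt : ∀ᵐ x ∂m, W x ^ (s / (1 - s)) * Z x ^ (s / (1 - s))
      ≤ ∑' i, ({x | W x < dyadic (i + 1)}.indicator
          fun _ => (dyadic (i + 1) * M i) ^ (s / (1 - s))) x := by
    filter_upwards [hWP, hZ] with x hx hxZ
    rcases eq_or_ne (W x) 0 with h0 | h0
    · simp [h0, ENNReal.zero_rpow_of_pos hR]
    obtain ⟨i, hi⟩ := exists_dyadic h0 hx
    refine le_trans ?_ (ENNReal.le_tsum i)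
    rw [indicator_of_mem (show x ∈ {x | W x < dyadic (i + 1)} from hi.2),
      ← ENNReal.mul_rpow_of_nonneg _ _ hR.le]
    gcongr
    · exact hi.2.le
    · refine hxZ.trans (iSup₂_mono fun y hy => iSup_mono' fun h => ⟨hi.1.trans h, le_rfl⟩)
  have hI : hardyInt m W Z s ≤ 2 ^ (1 / (1 - s)) * ∑' i, c i := by
    calc hardyInt m W Z s
        ≤ ∫⁻ t, ∑' i, ({x | W x < dyadic (i + 1)}.indicator
          fun _ => (dyadic (i + 1) * M i) ^ (s / (1 - s))) t ∂m := lintegral_mono_ae hpt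
      _ = ∑' i, (dyadic (i + 1) * M i) ^ (s / (1 - s)) * m {x | W x < dyadic (i + 1)} := by
          rw [lintegral_tsum fun i => (measurable_const.indicator
            (measurableSet_lt hW measurable_const)).aemeasurable]
          congr 1; ext i
          rw [lintegral_indicator_const (measurableSet_lt hW measurable_const)]
      _ ≤ ∑' i, 2 ^ (1 / (1 - s)) * c i := by
          refine ENNReal.tsum_le_tsum fun i => ?_
          calc _ ≤ (dyadic (i + 1) * M i) ^ (s / (1 - s)) * dyadic (i + 1) := by
                gcongr; exact hle _
            _ = dyadic (i + 1) ^ (1 / (1 - s)) * M i ^ (s / (1 - s)) := by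
                rw [ENNReal.mul_rpow_of_nonneg _ _ hR.le, ← dyadic_mul_rpow hs1]; ring
            _ = _ := by
                rw [dyadic_succ, ENNReal.mul_rpow_of_nonneg _ _ hQ.le, mul_assoc]
      _ = _ := ENNReal.tsum_mul_left
  have hS : (∑' i, c i) ^ (1 - s) ≤ 4 * K := by
    rw [ENNReal.tsum_eq_iSup_sum]
    exact rpow_iSup_le h1 hfin
  calc hardyInt m W Z s ^ (1 - s) ≤ (2 ^ (1 / (1 - s)) * ∑' i, c i) ^ (1 - s) := by gcongr
    _ = 2 * (∑' i, c i) ^ (1 - s) := by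
        rw [ENNReal.mul_rpow_of_nonneg _ _ h1.le, ← ENNReal.rpow_mul, div_mul_cancel₀ _ h1.ne',
          ENNReal.rpow_one]
    _ ≤ 2 * (4 * K) := by gcongr
    _ = 8 * K := by rw [← mul_assoc]; norm_num

/-! ### The operator on measures: reduction to point evaluations -/

/-- A measure without atoms, carried by `(0,∞)`, whose primitive is positive and finite there. -/
structure IsNondegenerate (m : Measure ℝ) : Prop where
  atom : NullSingletonClass m
  null : m (Iic 0) = 0
  pos : ∀ x, 0 < x → 0 < m (Iic x)
  lt_top : ∀ x, 0 < x → m (Iic x) < ∞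

lemma IsNondegenerate.ae_pos {m : Measure ℝ} (h : IsNondegenerate m) : ∀ᵐ x ∂m, 0 < x := by
  rw [ae_iff]
  simpa [Iic] using h.null

lemma IsNondegenerate.pos_of_ne_zero {m : Measure ℝ} (h : IsNondegenerate m) {x : ℝ}
    (hx : m (Iic x) ≠ 0) : 0 < x := by
  by_contra h'
  exact hx (measure_mono_null (Iic_subset_Iic.2 (not_lt.1 h')) h.null)

lemma IsNondegenerate.le_primitive_lt {m : Measure ℝ} (h : IsNondegenerate m) {x : ℝ}
    (hx : 0 < x) (r : ℝ≥0∞) (hr : r ≤ m (Iic x)) : r ≤ m {y | m (Iic y) < r} :=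
  have := h.atom
  le_measure_primitive_lt m (h.lt_top x hx).ne hr

/-- The least non-increasing majorant of `φ / V ^ 2`, where `V` is the primitive of `ν`. -/
noncomputable def majorant (ν : Measure ℝ) (φ : ℝ → ℝ≥0∞) (x : ℝ) : ℝ≥0∞ :=
  ⨆ τ ∈ Ici x, φ τ / ν (Iic τ) ^ 2

lemma antitone_majorant (ν : Measure ℝ) (φ : ℝ → ℝ≥0∞) : Antitone (majorant ν φ) :=
  fun _ _ h => biSup_mono fun _ hτ => le_trans h hτ

lemma lt_of_primitive_lt {m : Measure ℝ} {x y : ℝ} (h : m (Iic x) < m (Iic y)) : x < y := by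
  by_contra h'
  exact absurd h (not_lt.2 (measure_mono (Iic_subset_Iic.2 (not_lt.1 h'))))

lemma lt_of_tail_lt {m : Measure ℝ} {x y : ℝ} (h : m (Ioi x) < m (Ioi y)) : y < x := by
  by_contra h'
  exact absurd h (not_lt.2 (measure_mono (Ioi_subset_Ioi (not_lt.1 h'))))

variable {μ ν : Measure ℝ} {φ : ℝ → ℝ≥0∞} {s : ℝ}

/-- For `τ` in level `k + 1` the sample `y k` from the level below satisfies `y k < τ`, so `g τ ≤ g
(y k)`, and `V τ < 4 * 2 ^ k` yields `16 = 4 ^ 2`. The sum bound goes down one level again: `g ≥ g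
(y k)` on level `k - 1`, whose `ν`-measure is at least `2 ^ (k - 1)`. -/
theorem exists_supStar_le (hν : IsNondegenerate ν) {g : ℝ → ℝ≥0∞} (hg : AntitoneOn g (Ioi 0)) :
    ∃ (a : ℤ → ℝ≥0∞) (y : ℤ → ℝ), (∀ k, 0 < y k) ∧ ∑' k, a k ≤ 2 * ∫⁻ x, g x ∂ν ∧
      ∀ t, 0 < t → supStar (fun τ => g τ * φ τ) t
        ≤ 16 * ⨆ k, a k * (ν (Iic (y k)) * majorant ν φ (max t (y k))) := by
  classical
  set V : ℝ → ℝ≥0∞ := fun x => ν (Iic x) with hV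
  have hVm : Measurable V := measurable_primitive ν
  have hpos : ∀ {k x}, x ∈ level V k → 0 < x := fun {k x} hx =>
    hν.pos_of_ne_zero (ne_bot_of_le_ne_bot (dyadic_ne_zero k) hx.1)
  have hmeas : ∀ {k y}, y ∈ level V (k + 1) → dyadic k ≤ ν (level V k) := fun {k y} hy =>
    dyadic_le_measure_level (measure_primitive_lt_le ν) (hν.le_primitive_lt (hpos hy)) hy.1
  have hy : ∀ k, ∃ y, 0 < y ∧ ((level V k).Nonempty → y ∈ level V k) := by
    intro k
    by_cases h : (level V k).Nonempty
    · exact ⟨h.some, hpos h.some_mem, fun _ => h.some_mem⟩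
    · exact ⟨1, one_pos, fun h' => absurd h' h⟩
  choose y hy0 hy using hy
  refine ⟨fun k => if (level V k).Nonempty then g (y k) * dyadic k else 0, y, hy0, ?_, ?_⟩
  · calc _ ≤ ∑' k, 2 * ∫⁻ x in level V (k - 1), g x ∂ν := by
          refine ENNReal.tsum_le_tsum fun k => ?_
          split_ifs with h
          · have hyk : y k ∈ level V (k - 1 + 1) := by simpa using hy k h
            calc g (y k) * dyadic k = 2 * (g (y k) * dyadic (k - 1)) := by
                  rw [dyadic_pred]; ring
              _ ≤ 2 * (g (y k) * ν (level V (k - 1))) := by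
                  gcongr; exact hmeas hyk
              _ ≤ _ := by
                  gcongr
                  refine mul_measure_le_setLIntegral (measurableSet_level hVm _) fun x hx => ?_
                  exact hg (hpos hx) (hy0 k)
                    (lt_of_primitive_lt (level_index_lt hx hyk (by lia))).le
          · exact zero_le
      _ = 2 * ∑' k, ∫⁻ x in level V k, g x ∂ν := by
          rw [ENNReal.tsum_mul_left, ← (Equiv.addRight (1 : ℤ)).tsum_eq]
          simp
      _ ≤ _ := by gcongr; exact tsum_setLIntegral_level_le hVm _
  · intro t ht
    refine essSup_le_of_ae_le _ ?_
    filter_upwards [ae_restrict_mem measurableSet_Ici] with τ hτ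
    have hτ0 : 0 < τ := ht.trans_le hτ
    have hVτ0 : V τ ≠ 0 := (hν.pos τ hτ0).ne'
    have hVτt : V τ ≠ ∞ := (hν.lt_top τ hτ0).ne
    obtain ⟨i, hi⟩ := exists_dyadic hVτ0 hVτt
    obtain ⟨k, rfl⟩ : ∃ k, i = k + 1 := ⟨i - 1, by ring⟩
    -- A value in level `k + 1` forces positive mass in level `k`, so the default point of an empty
    -- level is never used.
    have hne : (level V k).Nonempty := by
      refine nonempty_of_measure_ne_zero (μ := ν) ?_
      exact ne_bot_of_le_ne_bot (dyadic_ne_zero k) (hmeas hi)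
    have hyτ : y k < τ := lt_of_primitive_lt (level_index_lt (hy k hne) hi (by lia))
    have hφ : φ τ ≤ majorant ν φ (max t (y k)) * (4 * dyadic k) ^ 2 := by
      calc φ τ = φ τ / V τ ^ 2 * V τ ^ 2 :=
            (ENNReal.div_mul_cancel (by simp [hVτ0]) (by simp [hVτt])).symm
        _ ≤ majorant ν φ (max t (y k)) * (4 * dyadic k) ^ 2 := by
            gcongr
            · exact le_iSup₂_of_le (f := fun τ (_ : τ ∈ Ici (max t (y k))) => φ τ / V τ ^ 2)
                τ (max_le hτ hyτ.le) le_rfl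
            · refine hi.2.le.trans (le_of_eq ?_)
              rw [dyadic_succ, dyadic_succ, ← mul_assoc]
              norm_num
    calc g τ * φ τ ≤ g (y k) * (majorant ν φ (max t (y k)) * (4 * dyadic k) ^ 2) := by
          gcongr
          exact hg (hy0 k) hτ0 hyτ.le
      _ = 16 * (g (y k) * dyadic k * (dyadic k * majorant ν φ (max t (y k)))) := by ring
      _ ≤ 16 * (g (y k) * dyadic k * (V (y k) * majorant ν φ (max t (y k)))) := by
          gcongr; exact (hy k hne).1
      _ ≤ _ := by
          gcongr
          refine le_iSup_of_le k ?_
          simp only [hne, if_true]; rfl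

/-- An essential supremum ignores the value at `τ` itself, but sees every interval to the right of
`τ`. One-sided limits suffice. -/
lemma le_essSup_of_tendsto {f h : ℝ → ℝ≥0∞} {t τ : ℝ} {L : ℝ≥0∞} (htτ : t ≤ τ)
    (hL : Filter.Tendsto h (nhdsWithin τ (Ioi τ)) (nhds L)) (hle : ∀ x, τ < x → h x ≤ f x) :
    L ≤ essSup f (volume.restrict (Ici t)) := by
  have hae : ∀ᵐ x ∂(volume.restrict (Ioi τ)), f x ≤ essSup f (volume.restrict (Ici t)) :=
    ae_mono (Measure.restrict_mono (fun x hx => htτ.trans (le_of_lt hx)) le_rfl) (ae_le_essSup (f := f))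
  rw [ae_restrict_iff' measurableSet_Ioi] at hae
  refine le_of_tendsto_of_frequently hL ?_
  intro hev
  obtain ⟨b, hb, hb'⟩ := (mem_nhdsGT_iff_exists_Ioo_subset).1 hev
  have hnull : volume (Ioo τ b) = 0 := by
    refine measure_mono_null (fun x hx => ?_) hae
    exact fun hx' => hb' hx ((hle x hx.1).trans (hx' hx.1))
  rw [Real.volume_Ioo] at hnull
  exact absurd hnull (by simpa using hb)

/-- The kernel `V y / V (max τ y) ^ 2` whose superpositions are the test functions. -/
noncomputable def testKernel (ν : Measure ℝ) (y τ : ℝ) : ℝ≥0∞ :=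
  ν (Iic y) / ν (Iic (max τ y)) ^ 2

lemma antitone_testKernel (ν : Measure ℝ) (y : ℝ) : Antitone (testKernel ν y) := by
  intro a b h
  unfold testKernel
  gcongr

lemma dyadic_natCast (n : ℕ) : dyadic n = 2 ^ n := by
  simp [dyadic]

/-- The kernel is `1 / V y` up to `y`, contributing `1`. Where `V` is about `2 ^ n * V y` it is at
most `4 ^ (-n) / V y` on a set of measure at most `2 ^ (n + 1) * V y`; the geometric series adds
`4`. -/
theorem lintegral_testKernel_le (hν : IsNondegenerate ν) {y : ℝ} (hy : 0 < y) :
    ∫⁻ τ, testKernel ν y τ ∂ν ≤ 5 := by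
  set V : ℝ → ℝ≥0∞ := fun x => ν (Iic x) with hV
  have hVm : Measurable V := measurable_primitive ν
  have h0 : V y ≠ 0 := (hν.pos y hy).ne'
  have ht : V y ≠ ∞ := (hν.lt_top y hy).ne
  have hcancel : V y / V y ^ 2 = (V y)⁻¹ := by
    rw [sq, ENNReal.div_eq_inv_mul, ENNReal.mul_inv (Or.inl h0) (Or.inl ht), mul_assoc,
      ENNReal.inv_mul_cancel h0 ht, mul_one]
  have hpt : ∀ τ, testKernel ν y τ ≤ (Iic y).indicator (fun _ => (V y)⁻¹) τ
      + ∑' n : ℕ, ({x | V x < 2 ^ (n + 1) * V y}.indicator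
          fun _ => (2⁻¹ ^ n * 2⁻¹ ^ n) * (V y)⁻¹) τ := by
    intro τ
    rcases le_or_gt τ y with h | h
    · refine le_trans ?_ le_self_add
      rw [indicator_of_mem (mem_Iic.2 h), testKernel, max_eq_right h, ← hcancel]
    · refine le_trans ?_ le_add_self
      have hVτt : V τ ≠ ∞ := (hν.lt_top τ (hy.trans h)).ne
      have hyτ : V y ≤ V τ := measure_mono (Iic_subset_Iic.2 h.le)
      have h1 : 1 ≤ V τ / V y := by
        rw [ENNReal.le_div_iff_mul_le (Or.inl h0) (Or.inl ht), one_mul]; exact hyτ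
      obtain ⟨i, hi⟩ := exists_dyadic (x := V τ / V y)
        (zero_lt_one.trans_le h1).ne' (ENNReal.div_ne_top hVτt h0)
      have hi0 : 0 ≤ i := by
        by_contra hneg
        have : dyadic (i + 1) ≤ dyadic (0 : ℕ) := dyadic_mono (by push_cast; lia)
        rw [dyadic_natCast, pow_zero] at this
        exact absurd (h1.trans_lt hi.2) (not_lt.2 this)
      obtain ⟨n, rfl⟩ := Int.eq_ofNat_of_zero_le hi0
      have hi2 : V τ < 2 ^ (n + 1) * V y := by
        rw [← ENNReal.div_lt_iff (Or.inl h0) (Or.inl ht), ← dyadic_natCast]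
        exact hi.2
      have hi1 : 2 ^ n * V y ≤ V τ := by
        rw [← ENNReal.le_div_iff_mul_le (Or.inl h0) (Or.inl ht), ← dyadic_natCast]
        exact hi.1
      refine le_trans ?_ (ENNReal.le_tsum n)
      rw [indicator_of_mem (show τ ∈ {x | V x < 2 ^ (n + 1) * V y} from hi2), testKernel,
        max_eq_left h.le]
      calc V y / V τ ^ 2 ≤ V y / (2 ^ n * V y) ^ 2 := by gcongr
        _ = (2⁻¹ ^ n * 2⁻¹ ^ n) * (V y)⁻¹ := by
            rw [mul_pow, ENNReal.div_eq_inv_mul,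
              ENNReal.mul_inv (Or.inr (by simp [ht])) (Or.inr (by simp [h0])), mul_assoc, ← hcancel,
              ENNReal.div_eq_inv_mul, sq (2 ^ n : ℝ≥0∞),
              ENNReal.mul_inv (Or.inr (by simp)) (Or.inr (by simp)), ENNReal.inv_pow]
  have hms : ∀ n : ℕ, MeasurableSet {x | V x < 2 ^ (n + 1) * V y} := fun n =>
    measurableSet_lt hVm measurable_const
  calc ∫⁻ τ, testKernel ν y τ ∂ν
      ≤ _ := lintegral_mono hpt
    _ = (V y)⁻¹ * V y + ∑' n : ℕ, (2⁻¹ ^ n * 2⁻¹ ^ n) * (V y)⁻¹ * ν {x | V x < 2 ^ (n + 1) * V y} := by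
        rw [lintegral_add_left (measurable_const.indicator measurableSet_Iic),
          lintegral_indicator_const measurableSet_Iic, lintegral_tsum fun n =>
            (measurable_const.indicator (hms n)).aemeasurable]
        congr 2; ext n
        rw [lintegral_indicator_const (hms n)]
    _ ≤ 1 + ∑' n : ℕ, 2 * 2⁻¹ ^ n := by
        rw [ENNReal.inv_mul_cancel h0 ht]
        refine add_le_add le_rfl (ENNReal.tsum_le_tsum fun n => ?_)
        calc 2⁻¹ ^ n * 2⁻¹ ^ n * (V y)⁻¹ * ν {x | V x < 2 ^ (n + 1) * V y}
            ≤ 2⁻¹ ^ n * 2⁻¹ ^ n * (V y)⁻¹ * (2 ^ (n + 1) * V y) := by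
              gcongr; exact measure_primitive_lt_le ν _
          _ = 2 * 2⁻¹ ^ n * (2⁻¹ * 2) ^ n * ((V y)⁻¹ * V y) := by rw [mul_pow]; ring
          _ = 2 * 2⁻¹ ^ n := by
              rw [ENNReal.inv_mul_cancel h0 ht, ENNReal.inv_mul_cancel (by simp) (by simp)]
              simp
    _ = 5 := by
        rw [ENNReal.tsum_mul_left, ENNReal.tsum_geometric, ENNReal.one_sub_inv_two, inv_inv]
        norm_num

/-- To the right of `y` the product of kernel and `φ` is `V y * φ / V ^ 2`. Continuity of `φ` and
right continuity of `V` turn the essential supremum into the pointwise one defining `majorant`. -/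
theorem le_supStar_testKernel (hν : IsNondegenerate ν) (hφ : ContinuousOn φ (Ioi 0))
    {g : ℝ → ℝ≥0∞} {c : ℝ≥0∞} {y t : ℝ} (hy : 0 < y)
    (hg : ∀ τ, c * testKernel ν y τ ≤ g τ) :
    c * (ν (Iic y) * majorant ν φ (max t y)) ≤ supStar (fun τ => g τ * φ τ) t := by
  rw [← mul_assoc, majorant, ENNReal.mul_iSup]
  refine iSup_le fun τ => ?_
  rw [ENNReal.mul_iSup]
  refine iSup_le fun hτ => ?_
  have hyτ : y ≤ τ := (le_max_right _ _).trans hτ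
  have hτ0 : 0 < τ := hy.trans_le hyτ
  -- The factor `c` may be infinite, and multiplication by `∞` is not continuous at `0`.
  rcases eq_or_ne (φ τ / ν (Iic τ) ^ 2) 0 with h0 | h0
  · simp [h0]
  refine le_essSup_of_tendsto (h := fun σ => c * ν (Iic y) * (φ σ / ν (Iic σ) ^ 2))
    ((le_max_left _ _).trans hτ) ?_ ?_
  · refine ENNReal.Tendsto.const_mul ?_ (Or.inl h0)
    have hV : Filter.Tendsto (fun σ => ν (Iic σ) ^ 2) (nhdsWithin τ (Ioi τ))
        (nhds (ν (Iic τ) ^ 2)) :=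
      ((ENNReal.continuous_pow 2).tendsto _).comp
        (tendsto_primitive_right ν (lt_add_one τ) (hν.lt_top _ (by linarith)).ne)
    exact ENNReal.Tendsto.div
      ((hφ.continuousAt (Ioi_mem_nhds hτ0)).tendsto.mono_left nhdsWithin_le_nhds)
      (Or.inr (by simp [(hν.pos τ hτ0).ne'])) hV
      (Or.inl (by simp [(hν.lt_top τ hτ0).ne]))
  · intro σ hσ
    calc c * ν (Iic y) * (φ σ / ν (Iic σ) ^ 2) = c * testKernel ν y σ * φ σ := by
          rw [testKernel, max_eq_left (hyτ.trans hσ.le), ENNReal.div_eq_inv_mul,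
            ENNReal.div_eq_inv_mul]
          ring
      _ ≤ g σ * φ σ := by gcongr; exact hg σ

/-- The inequality `∫ (S* (g φ)) ^ s dμ ≤ K (∫ g dν) ^ s` for non-increasing `g`. -/
def PowerIneq (μ ν : Measure ℝ) (φ : ℝ → ℝ≥0∞) (s : ℝ) (K : ℝ≥0∞) : Prop :=
  ∀ g : ℝ → ℝ≥0∞, AntitoneOn g (Ioi 0) →
    ∫⁻ t, supStar (fun τ => g τ * φ τ) t ^ s ∂μ ≤ K * (∫⁻ x, g x ∂ν) ^ s

theorem PowerIneq.lintegral_iSup_le (hν : IsNondegenerate ν) (hφ : ContinuousOn φ (Ioi 0))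
    (hs : 0 < s) {K : ℝ≥0∞} (hK : PowerIneq μ ν φ s K) (J : Finset ℤ) (y : ℤ → ℝ)
    (c : ℤ → ℝ≥0∞) (hy : ∀ j ∈ J, 0 < y j) :
    ∫⁻ t, (⨆ j ∈ J, c j * (ν (Iic (y j)) * majorant ν φ (max t (y j)))) ^ s ∂μ
      ≤ 5 ^ s * K * (∑ j ∈ J, c j) ^ s := by
  set g : ℝ → ℝ≥0∞ := fun τ => ∑ j ∈ J, c j * testKernel ν (y j) τ with hg
  have hanti : Antitone g := fun a b h =>
    Finset.sum_le_sum fun j _ => mul_le_mul_right (antitone_testKernel ν (y j) h) _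
  have hint : ∫⁻ x, g x ∂ν ≤ 5 * ∑ j ∈ J, c j := by
    rw [hg, lintegral_finsetSum _ fun j _ =>
      (antitone_testKernel ν (y j)).measurable.const_mul _, Finset.mul_sum]
    refine Finset.sum_le_sum fun j hj => ?_
    rw [lintegral_const_mul _ (antitone_testKernel ν (y j)).measurable, mul_comm]
    gcongr
    exact lintegral_testKernel_le hν (hy j hj)
  calc _ ≤ ∫⁻ t, supStar (fun τ => g τ * φ τ) t ^ s ∂μ := by
        refine lintegral_mono fun t => ?_
        dsimp only
        gcongr
        refine iSup₂_le fun j hj => le_supStar_testKernel hν hφ (hy j hj) fun τ => ?_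
        exact Finset.single_le_sum (f := fun j => c j * testKernel ν (y j) τ)
          (fun _ _ => zero_le) hj
    _ ≤ K * (5 * ∑ j ∈ J, c j) ^ s := (hK g (hanti.antitoneOn _)).trans (by gcongr)
    _ = _ := by rw [ENNReal.mul_rpow_of_nonneg _ _ hs.le]; ring

variable {μ ν : Measure ℝ} {φ : ℝ → ℝ≥0∞} {s : ℝ}

/-! ### Two-sided bounds for the best constant of `PowerIneq` -/

/-- The quantity `∫ (V(x) U(max t x)) ^ s dμ(t)`. -/
noncomputable def testInt (μ ν : Measure ℝ) (φ : ℝ → ℝ≥0∞) (s x : ℝ) : ℝ≥0∞ :=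
  ∫⁻ t, (ν (Iic x) * majorant ν φ (max t x)) ^ s ∂μ

/-- The measure `U ^ s dμ`. -/
noncomputable def majorantMeasure (μ ν : Measure ℝ) (φ : ℝ → ℝ≥0∞) (s : ℝ) : Measure ℝ :=
  μ.withDensity fun x => majorant ν φ x ^ s

lemma measurable_majorant_rpow (ν : Measure ℝ) (φ : ℝ → ℝ≥0∞) (s : ℝ) :
    Measurable fun x => majorant ν φ x ^ s :=
  (antitone_majorant ν φ).measurable.pow_const s

/-- Splitting at `t = x` gives the expression inside `A₁`. -/
lemma testInt_eq (hs : 0 < s) (x : ℝ) :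
    testInt μ ν φ s x = (majorant ν φ x ^ s * μ (Iic x) + majorantMeasure μ ν φ s (Ioi x))
      * ν (Iic x) ^ s := by
  rw [testInt, ← lintegral_add_compl _ (measurableSet_Iic (a := x)), compl_Iic,
    setLIntegral_congr_fun (g := fun _ => (ν (Iic x) * majorant ν φ x) ^ s) measurableSet_Iic
      (fun t ht => by simp only [max_eq_right (mem_Iic.1 ht)]),
    setLIntegral_congr_fun (g := fun t => ν (Iic x) ^ s * majorant ν φ t ^ s) measurableSet_Ioi
      (fun t ht => by
        simp only [max_eq_left (mem_Ioi.1 ht).le, ENNReal.mul_rpow_of_nonneg _ _ hs.le]),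
    setLIntegral_const, lintegral_const_mul _ (measurable_majorant_rpow ν φ s),
    majorantMeasure, withDensity_apply _ measurableSet_Ioi, ENNReal.mul_rpow_of_nonneg _ _ hs.le]
  ring

theorem PowerIneq.testInt_le (hν : IsNondegenerate ν) (hφ : ContinuousOn φ (Ioi 0))
    (hs : 0 < s) {K : ℝ≥0∞} (hK : PowerIneq μ ν φ s K) {x : ℝ} (hx : 0 < x) :
    testInt μ ν φ s x ≤ 5 ^ s * K := by
  simpa [testInt] using hK.lintegral_iSup_le hν hφ hs {0} (fun _ => x) (fun _ => 1) (fun _ _ => hx)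

lemma tsum_rpow_le_rpow_tsum {ι : Type*} (a : ι → ℝ≥0∞) (hs : 1 ≤ s) :
    ∑' k, a k ^ s ≤ (∑' k, a k) ^ s := by
  have h : ∀ x : ℝ≥0∞, x ^ s = x * x ^ (s - 1) := fun x => by
    conv_lhs => rw [← add_sub_cancel 1 s]
    rw [ENNReal.rpow_add_of_nonneg _ _ zero_le_one (sub_nonneg.2 hs), ENNReal.rpow_one]
  rw [h (∑' k, a k), ← ENNReal.tsum_mul_right]
  refine ENNReal.tsum_le_tsum fun k => ?_
  rw [h]
  exact mul_le_mul_right (ENNReal.rpow_le_rpow (ENNReal.le_tsum k) (sub_nonneg.2 hs)) _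

/-- The `s`-th power of the supremum is bounded by the sum of `s`-th powers, each integrated
separately; `s ≥ 1` then sums `a k ^ s`. Here `32 = 16 * 2`, both factors from `exists_supStar_le`.
-/
theorem powerIneq_of_testInt_le (hμ : IsNondegenerate μ) (hν : IsNondegenerate ν) (hs : 1 ≤ s)
    {K : ℝ≥0∞} (hK : ∀ x, 0 < x → testInt μ ν φ s x ≤ K) :
    PowerIneq μ ν φ s (32 ^ s * K) := by
  intro g hg
  have hs0 : 0 < s := zero_lt_one.trans_le hs
  obtain ⟨a, y, hy, ha, hle⟩ := exists_supStar_le (φ := φ) hν hg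
  have hmeas : ∀ x : ℝ, Measurable fun t => (ν (Iic x) * majorant ν φ (max t x)) ^ s := fun x =>
    (((antitone_majorant ν φ).measurable.comp (measurable_id.max measurable_const)).const_mul
      _).pow_const s
  calc ∫⁻ t, supStar (fun τ => g τ * φ τ) t ^ s ∂μ
      ≤ ∫⁻ t, ∑' k, 16 ^ s * (a k ^ s * (ν (Iic (y k)) * majorant ν φ (max t (y k))) ^ s) ∂μ := by
        refine lintegral_mono_ae ?_
        filter_upwards [hμ.ae_pos] with t ht
        calc supStar (fun τ => g τ * φ τ) t ^ s
            ≤ (16 * ⨆ k, a k * (ν (Iic (y k)) * majorant ν φ (max t (y k)))) ^ s := by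
              gcongr; exact hle t ht
          _ ≤ 16 ^ s * ∑' k, (a k * (ν (Iic (y k)) * majorant ν φ (max t (y k)))) ^ s := by
              rw [ENNReal.mul_rpow_of_nonneg _ _ hs0.le]
              gcongr
              exact rpow_iSup_le_tsum _ hs0
          _ = _ := by
              rw [← ENNReal.tsum_mul_left]
              congr 1; ext k
              rw [ENNReal.mul_rpow_of_nonneg (a k) _ hs0.le]
    _ = ∑' k, 16 ^ s * (a k ^ s * testInt μ ν φ s (y k)) := by
        rw [lintegral_tsum fun k => (((hmeas (y k)).const_mul _).const_mul _).aemeasurable]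
        congr 1; ext k
        rw [lintegral_const_mul _ ((hmeas (y k)).const_mul _), lintegral_const_mul _ (hmeas (y k)),
          testInt]
    _ ≤ ∑' k, 16 ^ s * (a k ^ s * K) := by
        gcongr with k
        exact hK _ (hy k)
    _ = 16 ^ s * K * ∑' k, a k ^ s := by
        rw [ENNReal.tsum_mul_left, ENNReal.tsum_mul_right]; ring
    _ ≤ 16 ^ s * K * (2 * ∫⁻ x, g x ∂ν) ^ s := by
        gcongr
        exact (tsum_rpow_le_rpow_tsum a hs).trans (by gcongr)
    _ = 32 ^ s * K * (∫⁻ x, g x ∂ν) ^ s := by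
        rw [ENNReal.mul_rpow_of_nonneg _ _ hs0.le, show (32 : ℝ≥0∞) = 16 * 2 by norm_num,
          ENNReal.mul_rpow_of_nonneg _ _ hs0.le]
        ring

/-- The integral that controls the part of a non-increasing function to the left of the
evaluation point. -/
noncomputable def leftInt (μ ν : Measure ℝ) (φ : ℝ → ℝ≥0∞) (s : ℝ) : ℝ≥0∞ :=
  hardyInt (majorantMeasure μ ν φ s) (fun x => majorantMeasure μ ν φ s (Ioi x))
    (fun x => ν (Iic x)) s

/-- The integral that controls the part of a non-increasing function to the right of the
evaluation point. -/
noncomputable def rightInt (μ ν : Measure ℝ) (φ : ℝ → ℝ≥0∞) (s : ℝ) : ℝ≥0∞ :=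
  hardyInt μ (fun x => μ (Iic x)) (fun x => ⨆ τ ∈ Ici x, majorant ν φ τ * ν (Iic τ)) s

lemma nullSingletonClass_majorantMeasure (hμ : IsNondegenerate μ) :
    NullSingletonClass (majorantMeasure μ ν φ s) := by
  have := hμ.atom
  exact ⟨fun x => withDensity_absolutelyContinuous μ _ (measure_singleton x)⟩

lemma ae_pos_majorantMeasure (hμ : IsNondegenerate μ) :
    ∀ᵐ x ∂majorantMeasure μ ν φ s, 0 < x :=
  (withDensity_absolutelyContinuous μ _).ae_le hμ.ae_pos

/-- An infinite tail at `x` is infinite at every `t ≤ x`, so the integrand of `leftInt` is `∞` on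
`(0, x]`. This interval has positive mass: `U x = 0` would make the tail vanish. -/
lemma majorantMeasure_Ioi_ne_top (hμ : IsNondegenerate μ) (hν : IsNondegenerate ν)
    (hs0 : 0 < s) (hs1 : s < 1) (h : leftInt μ ν φ s ≠ ∞) {x : ℝ} (hx : 0 < x) :
    majorantMeasure μ ν φ s (Ioi x) ≠ ∞ := by
  intro htop
  have hR : 0 < s / (1 - s) := div_pos hs0 (sub_pos.2 hs1)
  have hU : majorant ν φ x ^ s ≠ 0 := by
    intro h0
    have : majorantMeasure μ ν φ s (Ioi x) ≤ ∫⁻ _ in Ioi x, 0 ∂μ := by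
      rw [majorantMeasure, withDensity_apply _ measurableSet_Ioi]
      refine setLIntegral_mono' measurableSet_Ioi fun t ht => ?_
      rw [← h0]
      gcongr
      exact antitone_majorant ν φ (le_of_lt ht)
    simp [htop] at this
  have hpos : majorantMeasure μ ν φ s (Ioc 0 x) ≠ 0 := by
    have h1 : majorant ν φ x ^ s * μ (Ioc 0 x) ≤ majorantMeasure μ ν φ s (Ioc 0 x) := by
      rw [majorantMeasure, withDensity_apply _ measurableSet_Ioc]
      refine mul_measure_le_setLIntegral measurableSet_Ioc fun t ht => ?_
      gcongr
      exact antitone_majorant ν φ ht.2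
    refine ne_bot_of_le_ne_bot (mul_ne_zero hU ?_) h1
    intro h2
    refine (hμ.pos x hx).ne' (measure_mono_null (t := Iic 0 ∪ Ioc 0 x) ?_ ?_)
    · exact fun t ht => (le_or_gt t 0).imp id fun h => ⟨h, ht⟩
    · exact measure_union_null hμ.null h2
  refine h (top_le_iff.1 ?_)
  calc (∞ : ℝ≥0∞) = ∞ * majorantMeasure μ ν φ s (Ioc 0 x) := (ENNReal.top_mul hpos).symm
    _ ≤ _ := mul_measure_le_setLIntegral measurableSet_Ioc fun t ht => ?_
    _ ≤ leftInt μ ν φ s := setLIntegral_le_lintegral (Ioc 0 x) _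
  have h1 : majorantMeasure μ ν φ s (Ioi t) = ∞ :=
    top_le_iff.1 (htop ▸ measure_mono (Ioi_subset_Ioi ht.2))
  dsimp only
  rw [h1, ENNReal.top_rpow_of_pos hR, ENNReal.top_mul]
  simp [(hν.pos t ht.1).ne', hR.le]

theorem powerIneq_of_lt_one (hμ : IsNondegenerate μ) (hν : IsNondegenerate ν) (hs0 : 0 < s)
    (hs1 : s < 1) (hfin : leftInt μ ν φ s ≠ ∞) :
    PowerIneq μ ν φ s
      (4 * 32 ^ s * (leftInt μ ν φ s ^ (1 - s) + rightInt μ ν φ s ^ (1 - s))) := by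
  intro g hg
  obtain ⟨a, y, hy, ha, hle⟩ := exists_supStar_le (φ := φ) hν hg
  have hatom := hμ.atom
  have hatom' := nullSingletonClass_majorantMeasure (ν := ν) (φ := φ) (s := s) hμ
  set L : ℝ → ℝ≥0∞ := fun t => (⨆ k, ⨆ (_ : y k ≤ t), a k * ν (Iic (y k))) ^ s with hL
  set G : ℝ → ℝ≥0∞ := fun t =>
    (⨆ k, ⨆ (_ : t ≤ y k), a k * (majorant ν φ (y k) * ν (Iic (y k)))) ^ s with hG
  have hLm : Measurable L := by
    refine Measurable.pow_const (Monotone.measurable fun t t' h => ?_) s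
    exact iSup_mono fun k => iSup_mono' fun h' => ⟨h'.trans h, le_rfl⟩
  have hpt : ∀ t, 0 < t → supStar (fun τ => g τ * φ τ) t ^ s
      ≤ 16 ^ s * (majorant ν φ t ^ s * L t + G t) := by
    intro t ht
    calc supStar (fun τ => g τ * φ τ) t ^ s
        ≤ (16 * ⨆ k, a k * (ν (Iic (y k)) * majorant ν φ (max t (y k)))) ^ s := by
          gcongr; exact hle t ht
      _ = 16 ^ s * (⨆ k, a k * (ν (Iic (y k)) * majorant ν φ (max t (y k)))) ^ s :=
          ENNReal.mul_rpow_of_nonneg _ _ hs0.le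
      _ ≤ _ := by
          gcongr
          refine rpow_iSup_le hs0 fun k => ?_
          rcases le_total (y k) t with h | h
          · refine le_trans ?_ le_self_add
            rw [max_eq_left h, hL, ← ENNReal.mul_rpow_of_nonneg _ _ hs0.le, ← mul_assoc, mul_comm]
            gcongr
            exact le_iSup₂_of_le (f := fun k (_ : y k ≤ t) => a k * ν (Iic (y k))) k h le_rfl
          · refine le_trans ?_ le_add_self
            rw [max_eq_right h, mul_comm (ν _)]
            refine ENNReal.rpow_le_rpow ?_ hs0.le
            exact le_iSup₂_of_le
              (f := fun k (_ : t ≤ y k) => a k * (majorant ν φ (y k) * ν (Iic (y k)))) k h le_rfl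
  have hleft : ∫⁻ t, majorant ν φ t ^ s * L t ∂μ
      ≤ 4 * ((∑' k, a k) ^ s * leftInt μ ν φ s ^ (1 - s)) := by
    calc ∫⁻ t, majorant ν φ t ^ s * L t ∂μ = ∫⁻ t, L t ∂majorantMeasure μ ν φ s := by
          rw [majorantMeasure,
            lintegral_withDensity_eq_lintegral_mul _ (measurable_majorant_rpow ν φ s) hLm]
          rfl
      -- Replacing `y k ≤ t` by the weak inequality between tails only enlarges the supremum, and
      -- brings it into the form of the Hardy inequality.
      _ ≤ ∫⁻ t, (⨆ k, ⨆ (_ : majorantMeasure μ ν φ s (Ioi t)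
            ≤ majorantMeasure μ ν φ s (Ioi (y k))), a k * ν (Iic (y k))) ^ s
              ∂majorantMeasure μ ν φ s := by
          refine lintegral_mono fun t => ENNReal.rpow_le_rpow (iSup_mono fun k => ?_) hs0.le
          exact iSup_mono' fun h => ⟨measure_mono (Ioi_subset_Ioi h), le_rfl⟩
      _ ≤ _ := by
          refine lintegral_iSup_rpow_le hs0 hs1 (measurable_tail _) (measure_tail_lt_le _)
            (fun k => majorantMeasure_Ioi_ne_top hμ hν hs0 hs1 hfin (hy k))
            (fun k r hr => le_measure_tail_lt _
              (majorantMeasure_Ioi_ne_top hμ hν hs0 hs1 hfin (hy k)) hr) ?_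
          exact fun k x hx => measure_mono (Iic_subset_Iic.2 (lt_of_tail_lt hx).le)
  have hright : ∫⁻ t, G t ∂μ ≤ 4 * ((∑' k, a k) ^ s * rightInt μ ν φ s ^ (1 - s)) := by
    calc ∫⁻ t, G t ∂μ ≤ ∫⁻ t, (⨆ k, ⨆ (_ : μ (Iic t) ≤ μ (Iic (y k))),
            a k * (majorant ν φ (y k) * ν (Iic (y k)))) ^ s ∂μ := by
          refine lintegral_mono fun t => ENNReal.rpow_le_rpow (iSup_mono fun k => ?_) hs0.le
          exact iSup_mono' fun h => ⟨measure_mono (Iic_subset_Iic.2 h), le_rfl⟩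
      _ ≤ _ := by
          refine lintegral_iSup_rpow_le hs0 hs1 (measurable_primitive _)
            (measure_primitive_lt_le _) (fun k => (hμ.lt_top _ (hy k)).ne)
            (fun k r hr => hμ.le_primitive_lt (hy k) r hr) ?_
          exact fun k x hx => le_iSup₂_of_le
            (f := fun τ (_ : τ ∈ Ici x) => majorant ν φ τ * ν (Iic τ)) (y k)
            (lt_of_primitive_lt hx).le le_rfl
  calc ∫⁻ t, supStar (fun τ => g τ * φ τ) t ^ s ∂μ
      ≤ ∫⁻ t, 16 ^ s * (majorant ν φ t ^ s * L t + G t) ∂μ := by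
        refine lintegral_mono_ae ?_
        filter_upwards [hμ.ae_pos] with t ht using hpt t ht
    _ = 16 ^ s * (∫⁻ t, majorant ν φ t ^ s * L t ∂μ + ∫⁻ t, G t ∂μ) := by
        rw [lintegral_const_mul' _ _ (by simp)]
        congr 1
        exact lintegral_add_left ((measurable_majorant_rpow ν φ s).mul hLm) _
    _ ≤ 16 ^ s * (4 * ((∑' k, a k) ^ s * leftInt μ ν φ s ^ (1 - s))
          + 4 * ((∑' k, a k) ^ s * rightInt μ ν φ s ^ (1 - s))) := by gcongr
    _ = 4 * 16 ^ s * (leftInt μ ν φ s ^ (1 - s) + rightInt μ ν φ s ^ (1 - s))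
          * (∑' k, a k) ^ s := by ring
    _ ≤ 4 * 16 ^ s * (leftInt μ ν φ s ^ (1 - s) + rightInt μ ν φ s ^ (1 - s))
          * (2 * ∫⁻ x, g x ∂ν) ^ s := by gcongr
    _ = _ := by
        rw [ENNReal.mul_rpow_of_nonneg _ _ hs0.le, show (32 : ℝ≥0∞) = 16 * 2 by norm_num,
          ENNReal.mul_rpow_of_nonneg _ _ hs0.le]
        ring

theorem PowerIneq.leftInt_rpow_le (hμ : IsNondegenerate μ) (hν : IsNondegenerate ν)
    (hφ : ContinuousOn φ (Ioi 0)) (hs0 : 0 < s) (hs1 : s < 1) {K : ℝ≥0∞} (hKt : K ≠ ∞)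
    (hK : PowerIneq μ ν φ s K) : leftInt μ ν φ s ^ (1 - s) ≤ 8 * (5 ^ s * K) := by
  have hatom' := nullSingletonClass_majorantMeasure (ν := ν) (φ := φ) (s := s) hμ
  -- Here finiteness of the tail comes from the single-point test, since `leftInt` is not yet known
  -- to be finite.
  have hΩ : ∀ x, 0 < x → majorantMeasure μ ν φ s (Ioi x) ≠ ∞ := by
    intro x hx htop
    have := hK.testInt_le hν hφ hs0 hx
    rw [testInt_eq hs0, htop, add_top, ENNReal.top_mul (by simp [(hν.pos x hx).ne', hs0.le]),
      top_le_iff] at this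
    exact ENNReal.mul_ne_top (by simp) hKt this
  refine hardyInt_rpow_le hs0 hs1 (measurable_tail _) (measure_tail_lt_le _) (P := Ioi 0)
    (z := fun x => ν (Iic x)) ?_ (fun x hx r hr => le_measure_tail_lt _ (hΩ x hx) hr) ?_ ?_
  · filter_upwards [ae_pos_majorantMeasure hμ] with x hx using hΩ x hx
  · filter_upwards [ae_pos_majorantMeasure hμ] with x hx
    exact le_iSup₂_of_le x hx (le_iSup_of_le le_rfl le_rfl)
  · intro J y c hy
    refine le_trans ?_ (hK.lintegral_iSup_le hν hφ hs0 J y c hy)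
    rw [majorantMeasure, lintegral_withDensity_eq_lintegral_mul _ (measurable_majorant_rpow ν φ s)]
    -- Strict inequality of tails gives `y j < t`, hence `max t (y j) = t`, and the density `U t ^
    -- s` is absorbed into the supremum.
    · refine lintegral_mono fun t => ?_
      rw [Pi.mul_apply, ← ENNReal.mul_rpow_of_nonneg _ _ hs0.le]
      gcongr
      simp only [ENNReal.mul_iSup]
      gcongr with j hj
      refine iSup_le fun h => ?_
      rw [max_eq_left (lt_of_tail_lt h).le]
      exact le_of_eq (by ring)
    · refine Measurable.pow_const (Monotone.measurable fun t t' h => ?_) s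
      gcongr with j hj
      exact iSup_mono' fun h' => ⟨(measure_mono (Ioi_subset_Ioi h)).trans_lt h', le_rfl⟩

theorem PowerIneq.rightInt_rpow_le (hμ : IsNondegenerate μ) (hν : IsNondegenerate ν)
    (hφ : ContinuousOn φ (Ioi 0)) (hs0 : 0 < s) (hs1 : s < 1) {K : ℝ≥0∞}
    (hK : PowerIneq μ ν φ s K) : rightInt μ ν φ s ^ (1 - s) ≤ 8 * (5 ^ s * K) := by
  have hatom := hμ.atom
  refine hardyInt_rpow_le hs0 hs1 (measurable_primitive _) (measure_primitive_lt_le _)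
    (P := Ioi 0) (z := fun x => majorant ν φ x * ν (Iic x)) ?_
    (fun x hx r hr => hμ.le_primitive_lt hx r hr) ?_ ?_
  · filter_upwards [hμ.ae_pos] with x hx using (hμ.lt_top x hx).ne
  · filter_upwards [hμ.ae_pos] with x hx
    exact iSup₂_mono' fun τ hτ => ⟨τ, hx.trans_le hτ,
      le_iSup_of_le (measure_mono (Iic_subset_Iic.2 hτ)) le_rfl⟩
  · intro J y c hy
    refine le_trans (lintegral_mono fun t => ?_) (hK.lintegral_iSup_le hν hφ hs0 J y c hy)
    dsimp only
    gcongr with j hj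
    refine iSup_le fun h => ?_
    rw [max_eq_right (lt_of_primitive_lt h).le, mul_comm (majorant _ _ _)]

/-! ### Translation to weights -/

/-- The measure with density `w` on `(0,∞)`. -/
noncomputable def weightMeasure (w : ℝ → ℝ≥0∞) : Measure ℝ :=
  (volume.restrict (Ioi 0)).withDensity w

variable {u : ℝ → ℝ≥0} {v w : ℝ → ℝ≥0∞} {p q : ℝ}

lemma weightMeasure_Iic (w : ℝ → ℝ≥0∞) (x : ℝ) : weightMeasure w (Iic x) = primitive w x := by
  rw [weightMeasure, withDensity_apply _ measurableSet_Iic,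
    Measure.restrict_restrict measurableSet_Iic, inter_comm, Ioi_inter_Iic, primitive]

lemma isNondegenerate_weightMeasure
    (h : ∀ x : ℝ, 0 < x → 0 < primitive w x ∧ primitive w x < ∞) :
    IsNondegenerate (weightMeasure w) where
  atom := ⟨fun x => withDensity_absolutelyContinuous _ _ (measure_singleton x)⟩
  null := by simp [weightMeasure_Iic, primitive]
  pos x hx := by rw [weightMeasure_Iic]; exact (h x hx).1
  lt_top x hx := by rw [weightMeasure_Iic]; exact (h x hx).2

lemma lintegral_weightMeasure (hw : IsWeight w) {g : ℝ → ℝ≥0∞}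
    (hg : AEMeasurable g (volume.restrict (Ioi 0))) :
    ∫⁻ x, g x ∂weightMeasure w = ∫⁻ x in Ioi 0, g x * w x := by
  rw [weightMeasure, lintegral_withDensity_eq_lintegral_mul₀ hw.aemeasurable hg]
  simp only [Pi.mul_apply, mul_comm]

lemma setLIntegral_weightMeasure (hw : IsWeight w) {g : ℝ → ℝ≥0∞} (hg : Measurable g) {x : ℝ}
    (hx : 0 ≤ x) : ∫⁻ t in Ioi x, g t ∂weightMeasure w = ∫⁻ t in Ioi x, g t * w t := by
  have hsub : Ioi x ⊆ Ioi 0 := Ioi_subset_Ioi hx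
  rw [weightMeasure, restrict_withDensity measurableSet_Ioi,
    Measure.restrict_restrict measurableSet_Ioi, inter_eq_left.2 hsub,
    lintegral_withDensity_eq_lintegral_mul₀
      (hw.aemeasurable.mono_measure (Measure.restrict_mono hsub le_rfl)) hg.aemeasurable]
  simp only [Pi.mul_apply, mul_comm]

lemma majorant_weightMeasure (p : ℝ) (u : ℝ → ℝ≥0) (v : ℝ → ℝ≥0∞) :
    majorant (weightMeasure v) (fun τ => (u τ : ℝ≥0∞) ^ p) = envelope p u v := by
  ext x
  simp only [majorant, envelope, weightMeasure_Iic]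

/-- For `p > 0` the power map is an order isomorphism of `[0, ∞]`, so it commutes with the essential
supremum. -/
lemma supStar_rpow (hp : 0 < p) (h : ℝ → ℝ≥0∞) (t : ℝ) :
    supStar h t ^ p = supStar (fun τ => h τ ^ p) t :=
  (ENNReal.orderIsoRpow p hp).essSup_apply h (volume.restrict (Ici t))

lemma antitone_supStar (h : ℝ → ℝ≥0∞) : Antitone (supStar h) := fun _ _ hab =>
  essSup_mono_measure' (Measure.restrict_mono (Ici_subset_Ici.2 hab) le_rfl)

lemma wnorm_rpow (hw : IsWeight w) (hp : 0 < p) {g : ℝ → ℝ≥0∞}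
    (hg : AEMeasurable g (volume.restrict (Ioi 0))) :
    wnorm p w g ^ q = (∫⁻ x, g x ^ p ∂weightMeasure w) ^ (q / p) := by
  rw [wnorm, ← ENNReal.rpow_mul, lintegral_weightMeasure hw (hg.pow_const p)]
  congr 1; field_simp

lemma wnorm_supStarU_rpow (hw : IsWeight w) (hp : 0 < p) (hq : 0 < q) (f : ℝ → ℝ≥0∞) :
    wnorm q w (supStarU u f) ^ q
      = ∫⁻ t, supStar (fun τ => f τ ^ p * (u τ : ℝ≥0∞) ^ p) t ^ (q / p) ∂weightMeasure w := by
  rw [wnorm_rpow hw hq (g := supStarU u f) (antitone_supStar _).measurable.aemeasurable, div_self hq.ne',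
    ENNReal.rpow_one]
  congr 1; ext t
  have : (fun τ => f τ ^ p * (u τ : ℝ≥0∞) ^ p) = fun τ => (f τ * u τ) ^ p := by
    ext τ; rw [ENNReal.mul_rpow_of_nonneg _ _ hp.le]
  rw [this, ← supStar_rpow hp, ← ENNReal.rpow_mul, mul_div_cancel₀ _ hp.ne', supStarU]

lemma wnorm_le_iff (hv : IsWeight v) (hw : IsWeight w) (hp : 0 < p) (hq : 0 < q) {c : ℝ≥0∞}
    {f : ℝ → ℝ≥0∞} (hf : AntitoneOn f (Ioi 0)) :
    wnorm q w (supStarU u f) ≤ c * wnorm p v f ↔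
      ∫⁻ t, supStar (fun τ => f τ ^ p * (u τ : ℝ≥0∞) ^ p) t ^ (q / p) ∂weightMeasure w
        ≤ c ^ q * (∫⁻ x, f x ^ p ∂weightMeasure v) ^ (q / p) := by
  rw [← wnorm_supStarU_rpow hw hp hq,
    ← wnorm_rpow hv hp (aemeasurable_restrict_of_antitoneOn measurableSet_Ioi hf),
    ← ENNReal.mul_rpow_of_nonneg _ _ hq.le, ENNReal.rpow_le_rpow_iff hq]

/-- The map `f ↦ f ^ p` is a bijection of the non-increasing functions, with inverse `g ↦ g ^ p⁻¹`.
-/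
theorem restrictedIneq_iff (hv : IsWeight v) (hw : IsWeight w) (hp : 0 < p) (hq : 0 < q)
    (c : ℝ≥0) : RestrictedIneq p q u v w c ↔
      PowerIneq (weightMeasure w) (weightMeasure v) (fun τ => (u τ : ℝ≥0∞) ^ p) (q / p)
        ((c : ℝ≥0∞) ^ q) := by
  refine ⟨fun h g hg => ?_, fun h f hf => ?_⟩
  · have hf : AntitoneOn (fun x => g x ^ p⁻¹) (Ioi 0) := fun x hx y hy hxy =>
      ENNReal.rpow_le_rpow (hg hx hy hxy) (inv_nonneg.2 hp.le)
    have := (wnorm_le_iff hv hw hp hq hf).1 (h _ hf)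
    simpa only [ENNReal.rpow_inv_rpow hp.ne'] using this
  · exact (wnorm_le_iff hv hw hp hq hf).2
      (h (fun x => f x ^ p) fun x hx y hy hxy => ENNReal.rpow_le_rpow (hf hx hy hxy) hp.le)

lemma testTerm_le {c : ℝ≥0} (h : RestrictedIneq p q u v w c) : testTerm p q u v w ≤ c :=
  ENNReal.div_le_of_le_mul (h _ antitoneOn_const)

lemma majorantMeasure_weightMeasure (hw : IsWeight w) (s : ℝ) {x : ℝ} (hx : 0 ≤ x) :
    majorantMeasure (weightMeasure w) (weightMeasure v) (fun τ => (u τ : ℝ≥0∞) ^ p) s (Ioi x)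
      = ∫⁻ t in Ioi x, envelope p u v t ^ s * w t := by
  rw [majorantMeasure, withDensity_apply _ measurableSet_Ioi,
    setLIntegral_weightMeasure hw (measurable_majorant_rpow _ _ _) hx, majorant_weightMeasure]

lemma constA₁_eq (hw : IsWeight w) (hp : 0 < p) (hq : 0 < q) :
    constA₁ p q u v w = ⨆ x ∈ Ioi (0 : ℝ), testInt (weightMeasure w) (weightMeasure v)
      (fun τ => (u τ : ℝ≥0∞) ^ p) (q / p) x ^ (1 / q) := by
  refine iSup_congr fun x => iSup_congr fun hx => ?_
  rw [testInt_eq (div_pos hq hp), majorantMeasure_weightMeasure hw _ (le_of_lt hx),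
    majorant_weightMeasure, weightMeasure_Iic, weightMeasure_Iic,
    ENNReal.mul_rpow_of_nonneg _ _ (by positivity), ← ENNReal.rpow_mul _ (q / p)]
  congr 2; field_simp

/-- The exponent in `B₁` and `B₂` is the Hardy exponent `s / (1 - s)` for `s = q / p`. -/
lemma expR_div (hp : 0 < p) (hq : 0 < q) (hqp : q < p) :
    expR p q / p = q / p / (1 - q / p) := by
  have : p - q ≠ 0 := by linarith
  have h1 : 1 / q - 1 / p = (p - q) / (q * p) := by field_simp
  have h2 : 1 - q / p = (p - q) / p := by field_simp
  rw [expR, h1, h2]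
  field_simp

lemma one_div_expR_mul (hp : 0 < p) (hq : 0 < q) : 1 / expR p q * q = 1 - q / p := by
  rw [expR, one_div, inv_inv]
  field_simp

lemma constB₁_rpow (hw : IsWeight w) (hp : 0 < p) (hq : 0 < q) (hqp : q < p) :
    constB₁ p q u v w ^ q = leftInt (weightMeasure w) (weightMeasure v)
      (fun τ => (u τ : ℝ≥0∞) ^ p) (q / p) ^ (1 - q / p) := by
  rw [constB₁, ← ENNReal.rpow_mul, one_div_expR_mul hp hq, expR_div hp hq hqp, leftInt, hardyInt]
  congr 1
  have hm : Measurable fun x =>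
      majorantMeasure (weightMeasure w) (weightMeasure v) (fun τ => (u τ : ℝ≥0∞) ^ p) (q / p)
        (Ioi x) ^ (q / p / (1 - q / p)) * weightMeasure v (Iic x) ^ (q / p / (1 - q / p)) :=
    ((measurable_tail _).pow_const _).mul ((measurable_primitive _).pow_const _)
  have hd := lintegral_withDensity_eq_lintegral_mul (weightMeasure w)
    (measurable_majorant_rpow (weightMeasure v) (fun τ => (u τ : ℝ≥0∞) ^ p) (q / p)) hm
  rw [← majorantMeasure] at hd
  rw [hd, lintegral_weightMeasure hw ((measurable_majorant_rpow _ _ _).mul hm).aemeasurable]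
  refine setLIntegral_congr_fun measurableSet_Ioi fun x hx => ?_
  simp only [Pi.mul_apply, majorantMeasure_weightMeasure hw _ (le_of_lt hx),
    majorant_weightMeasure, weightMeasure_Iic]
  ring

lemma constB₂_rpow (hw : IsWeight w) (hp : 0 < p) (hq : 0 < q) (hqp : q < p) :
    constB₂ p q u v w ^ q = rightInt (weightMeasure w) (weightMeasure v)
      (fun τ => (u τ : ℝ≥0∞) ^ p) (q / p) ^ (1 - q / p) := by
  rw [constB₂, ← ENNReal.rpow_mul, one_div_expR_mul hp hq, expR_div hp hq hqp, rightInt, hardyInt]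
  congr 1
  rw [lintegral_weightMeasure hw]
  · simp only [majorant_weightMeasure, weightMeasure_Iic]
  · refine (((measurable_primitive _).pow_const _).mul (Measurable.pow_const ?_ _)).aemeasurable
    exact Antitone.measurable fun a b hab => biSup_mono fun τ hτ => le_trans hab hτ

/-- A quantity `D` that is admissible up to the factor `C`, and dominated by `C` times each
admissible constant, is equivalent to the best constant. -/
lemma bestConst_equiv {D : ℝ≥0∞} {C : ℝ≥0} (hC : 0 < C)
    (up : D < ∞ → ∃ c : ℝ≥0, (c : ℝ≥0∞) ≤ C * D ∧ RestrictedIneq p q u v w c)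
    (low : ∀ c : ℝ≥0, RestrictedIneq p q u v w c → D ≤ C * c) :
    ((∃ c : ℝ≥0, RestrictedIneq p q u v w c) ↔ D < ∞) ∧
      bestConst p q u v w ≤ C * D ∧ D ≤ C * bestConst p q u v w := by
  have hC0 : (C : ℝ≥0∞) ≠ 0 := by exact_mod_cast hC.ne'
  refine ⟨⟨fun ⟨c, hc⟩ => (low c hc).trans_lt (by finiteness), fun h => ?_⟩, ?_, ?_⟩
  · obtain ⟨c, -, hc⟩ := up h
    exact ⟨c, hc⟩
  · rcases eq_or_ne D ∞ with rfl | h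
    · rw [ENNReal.mul_top hC0]; exact le_top
    · obtain ⟨c, hcD, hc⟩ := up h.lt_top
      exact (iInf₂_le c hc).trans hcD
  · rw [mul_comm, ← ENNReal.div_le_iff_le_mul (Or.inl hC0) (Or.inl ENNReal.coe_ne_top)]
    refine le_iInf₂ fun c hc => ?_
    rw [ENNReal.div_le_iff_le_mul (Or.inl hC0) (Or.inl ENNReal.coe_ne_top), mul_comm]
    exact low c hc

lemma PowerIneq.mono {μ ν : Measure ℝ} {φ : ℝ → ℝ≥0∞} {s : ℝ} {K K' : ℝ≥0∞}
    (h : PowerIneq μ ν φ s K) (hK : K ≤ K') : PowerIneq μ ν φ s K' :=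
  fun g hg => (h g hg).trans (by gcongr)

lemma le_rpow_mul_of_rpow_le {a b c : ℝ≥0∞} (hq : 0 < q) (h : a ^ q ≤ b * c ^ q) :
    a ≤ b ^ (1 / q) * c := by
  rw [← ENNReal.rpow_le_rpow_iff hq, ENNReal.mul_rpow_of_nonneg _ _ hq.le, ← ENNReal.rpow_mul,
    one_div_mul_cancel hq.ne', ENNReal.rpow_one]
  exact h

lemma exists_restrictedIneq (hv : IsWeight v) (hw : IsWeight w) (hp : 0 < p) (hq : 0 < q)
    {b D : ℝ≥0∞} (hb : b ≠ ∞) (hD : D ≠ ∞)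
    (h : PowerIneq (weightMeasure w) (weightMeasure v) (fun τ => (u τ : ℝ≥0∞) ^ p) (q / p)
      (b * D ^ q)) :
    ∃ c : ℝ≥0, (c : ℝ≥0∞) = b ^ (1 / q) * D ∧ RestrictedIneq p q u v w c := by
  have hne : b ^ (1 / q) * D ≠ ∞ :=
    ENNReal.mul_ne_top (ENNReal.rpow_ne_top_of_nonneg (by positivity) hb) hD
  refine ⟨_, ENNReal.coe_toNNReal hne, ?_⟩
  rw [restrictedIneq_iff hv hw hp hq, ENNReal.coe_toNNReal hne]
  refine h.mono (le_of_eq ?_)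
  rw [ENNReal.mul_rpow_of_nonneg _ _ hq.le, ← ENNReal.rpow_mul, one_div_mul_cancel hq.ne',
    ENNReal.rpow_one]

end SupremalOp

/-! ### The equivalence, with a constant depending only on `p` and `q` -/

open SupremalOp in
theorem mainTheorem8 (p q : ℝ) (hp : 0 < p) (hq : 0 < q) :
    ∃ C : ℝ≥0, 0 < C ∧
      ∀ (u : ℝ → ℝ≥0) (v w : ℝ → ℝ≥0∞),
        ContinuousOn u (Ioi 0) →
        SupremalOp.IsWeight v → SupremalOp.IsWeight w →
        (∀ x : ℝ, 0 < x → 0 < SupremalOp.primitive v x ∧ SupremalOp.primitive v x < ∞) →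
        (∀ x : ℝ, 0 < x → 0 < SupremalOp.primitive w x ∧ SupremalOp.primitive w x < ∞) →
        (p ≤ q →
          ((∃ c : ℝ≥0, SupremalOp.RestrictedIneq p q u v w c) ↔
            SupremalOp.constA₁ p q u v w + SupremalOp.testTerm p q u v w < ∞) ∧
          SupremalOp.bestConst p q u v w ≤
            C * (SupremalOp.constA₁ p q u v w + SupremalOp.testTerm p q u v w) ∧
          SupremalOp.constA₁ p q u v w + SupremalOp.testTerm p q u v w ≤
            C * SupremalOp.bestConst p q u v w) ∧
        (q < p →
          ((∃ c : ℝ≥0, SupremalOp.RestrictedIneq p q u v w c) ↔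
            SupremalOp.constB₁ p q u v w + SupremalOp.constB₂ p q u v w
              + SupremalOp.testTerm p q u v w < ∞) ∧
          SupremalOp.bestConst p q u v w ≤
            C * (SupremalOp.constB₁ p q u v w + SupremalOp.constB₂ p q u v w
              + SupremalOp.testTerm p q u v w) ∧
          SupremalOp.constB₁ p q u v w + SupremalOp.constB₂ p q u v w
              + SupremalOp.testTerm p q u v w ≤
            C * SupremalOp.bestConst p q u v w) := by
  set s := q / p with hs
  have hs0 : 0 < s := div_pos hq hp
  have hq1 : 0 ≤ 1 / q := by positivity
  set a₁ : ℝ≥0∞ := 32 ^ s with ha₁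
  set a₂ : ℝ≥0∞ := 8 * 5 ^ s with ha₂
  set a₃ : ℝ≥0∞ := 8 * 32 ^ s with ha₃
  have h1 : a₁ ≠ ∞ := ENNReal.rpow_ne_top_of_nonneg hs0.le (by simp)
  have h2 : a₂ ≠ ∞ :=
    ENNReal.mul_ne_top (by simp) (ENNReal.rpow_ne_top_of_nonneg hs0.le (by simp))
  have h3 : a₃ ≠ ∞ :=
    ENNReal.mul_ne_top (by simp) (ENNReal.rpow_ne_top_of_nonneg hs0.le (by simp))
  -- The outer summands serve sufficiency for `p ≤ q` and `q < p`; the middle one serves necessity,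
  -- with one `a₂` term for each of `B₁`, `B₂` and `1` for `T`.
  obtain ⟨C, hC⟩ : ∃ C : ℝ≥0, (C : ℝ≥0∞)
      = a₁ ^ (1 / q) + (a₂ ^ (1 / q) + a₂ ^ (1 / q) + 1) + a₃ ^ (1 / q) := by
    refine ⟨_, ENNReal.coe_toNNReal ?_⟩
    have h1' := ENNReal.rpow_ne_top_of_nonneg hq1 h1
    have h2' := ENNReal.rpow_ne_top_of_nonneg hq1 h2
    have h3' := ENNReal.rpow_ne_top_of_nonneg hq1 h3
    finiteness
  have hC1 : a₁ ^ (1 / q) ≤ C := by rw [hC, add_assoc]; exact le_self_add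
  have hC2 : a₂ ^ (1 / q) + a₂ ^ (1 / q) + 1 ≤ C := by
    rw [hC]; exact le_trans le_add_self le_self_add
  have hC3 : a₃ ^ (1 / q) ≤ C := by rw [hC]; exact le_add_self
  have hC0 : 0 < C := by
    have : (1 : ℝ≥0∞) ≤ C := le_trans le_add_self hC2
    exact zero_lt_one.trans_le (by exact_mod_cast this)
  refine ⟨C, hC0, fun u v w hu hv hw hV hW => ?_⟩
  have hμ := isNondegenerate_weightMeasure hW
  have hν := isNondegenerate_weightMeasure hV
  have hφ : ContinuousOn (fun τ => (u τ : ℝ≥0∞) ^ p) (Ioi 0) :=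
    (ENNReal.continuous_rpow_const.comp ENNReal.continuous_coe).comp_continuousOn hu
  refine ⟨fun hpq => bestConst_equiv hC0 (fun hD => ?_) fun c hc => ?_,
    fun hqp => bestConst_equiv hC0 (fun hD => ?_) fun c hc => ?_⟩
  · have hA : constA₁ p q u v w ≠ ∞ := (le_self_add.trans_lt hD).ne
    have hP := powerIneq_of_testInt_le (φ := fun τ => (u τ : ℝ≥0∞) ^ p) hμ hν (s := s)
      ((one_le_div hp).2 hpq) (K := constA₁ p q u v w ^ q) fun x hx => by
        rw [constA₁_eq hw hp hq]
        refine le_trans (le_of_eq ?_) (ENNReal.rpow_le_rpow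
          (le_iSup₂_of_le (f := fun x (_ : x ∈ Ioi (0 : ℝ)) => testInt (weightMeasure w)
            (weightMeasure v) (fun τ => (u τ : ℝ≥0∞) ^ p) s x ^ (1 / q)) x hx le_rfl) hq.le)
        rw [← ENNReal.rpow_mul, one_div_mul_cancel hq.ne', ENNReal.rpow_one]
    obtain ⟨c, hc, hcR⟩ := exists_restrictedIneq hv hw hp hq h1 hA hP
    refine ⟨c, ?_, hcR⟩
    rw [hc]
    gcongr
    exact le_self_add
  · have hP := (restrictedIneq_iff hv hw hp hq c).1 hc
    have hA : constA₁ p q u v w ≤ a₂ ^ (1 / q) * c := by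
      rw [constA₁_eq hw hp hq]
      refine iSup₂_le fun x hx => le_rpow_mul_of_rpow_le hq ?_
      rw [← ENNReal.rpow_mul, one_div_mul_cancel hq.ne', ENNReal.rpow_one]
      refine (hP.testInt_le hν hφ hs0 hx).trans ?_
      gcongr
      exact le_mul_of_one_le_left zero_le (by norm_num)
    calc _ ≤ a₂ ^ (1 / q) * c + c := add_le_add hA (testTerm_le hc)
      _ = (a₂ ^ (1 / q) + 1) * c := by ring
      _ ≤ C * c := by
        gcongr
        refine le_trans ?_ hC2
        gcongr
        exact le_self_add
  · have hs1 : s < 1 := (div_lt_one hp).2 hqp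
    have hB : constB₁ p q u v w + constB₂ p q u v w ≠ ∞ := (le_self_add.trans_lt hD).ne
    have hB₁ : constB₁ p q u v w ≠ ∞ := ne_top_of_le_ne_top hB le_self_add
    have hfin : leftInt (weightMeasure w) (weightMeasure v) (fun τ => (u τ : ℝ≥0∞) ^ p) s ≠ ∞ := by
      intro h
      have := constB₁_rpow (u := u) (v := v) hw hp hq hqp
      rw [← hs, h, ENNReal.top_rpow_of_pos (sub_pos.2 hs1)] at this
      exact ENNReal.rpow_ne_top_of_nonneg hq.le hB₁ this
    have hP := powerIneq_of_lt_one hμ hν hs0 hs1 hfin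
    rw [← constB₁_rpow hw hp hq hqp, ← constB₂_rpow hw hp hq hqp] at hP
    -- The sum `B₁ ^ q + B₂ ^ q` is at most `2 * (B₁ + B₂) ^ q`, which doubles `4` to the `8` in
    -- `a₃`.
    have hP' := hP.mono (K' := a₃ * (constB₁ p q u v w + constB₂ p q u v w) ^ q) (by
      calc _ ≤ 4 * 32 ^ s * ((constB₁ p q u v w + constB₂ p q u v w) ^ q
              + (constB₁ p q u v w + constB₂ p q u v w) ^ q) := by
            gcongr
            · exact le_self_add
            · exact le_add_self
        _ = _ := by rw [ha₃]; ring)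
    obtain ⟨c, hc, hcR⟩ := exists_restrictedIneq hv hw hp hq h3 hB hP'
    refine ⟨c, ?_, hcR⟩
    rw [hc]
    exact mul_le_mul' hC3 le_self_add
  · have hs1 : s < 1 := (div_lt_one hp).2 hqp
    have hP := (restrictedIneq_iff hv hw hp hq c).1 hc
    have hB₁ : constB₁ p q u v w ≤ a₂ ^ (1 / q) * c := by
      refine le_rpow_mul_of_rpow_le hq ?_
      rw [constB₁_rpow hw hp hq hqp, ha₂, mul_assoc]
      exact hP.leftInt_rpow_le hμ hν hφ hs0 hs1
        (ENNReal.rpow_ne_top_of_nonneg hq.le ENNReal.coe_ne_top)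
    have hB₂ : constB₂ p q u v w ≤ a₂ ^ (1 / q) * c := by
      refine le_rpow_mul_of_rpow_le hq ?_
      rw [constB₂_rpow hw hp hq hqp, ha₂, mul_assoc]
      exact hP.rightInt_rpow_le hμ hν hφ hs0 hs1
    calc _ ≤ a₂ ^ (1 / q) * c + a₂ ^ (1 / q) * c + c :=
          add_le_add (add_le_add hB₁ hB₂) (testTerm_le hc)
      _ = (a₂ ^ (1 / q) + a₂ ^ (1 / q) + 1) * c := by ring
      _ ≤ C * c := by gcongr
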